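/- Conventions. All spaces are over $\mathbb C$. A vertex algebra is $V=(V,Y,\mathbf 1,T)$ with $Y(a,z)=\sum_{n\in\mathbb Z}a(n)z^{-n-1}$. A $\mathbb C$-graded vertex algebra is a vertex algebra with a decomposition $V=\bigoplus_{\mu\in\mathbb C}V_\mu$ such that $a(n)V_\mu\subseteq V_{\mu+\lambda-n-1}$ for $a\in V_\lambda$, and such that $V$ is generated, as a module over itself, by lowest weight vectors. Here a homogeneous vector $w$ (of $V$, or of a graded $V$-module) is a lowest weight vector if for every $\lambda$, every $a\in V_\lambda$ and every $n\in\mathbb Z$, $a(n)w\neq 0$ implies $n=\lambda-1$ or $n<\operatorname{Re}\lambda-1$. An admissible $V$-module is a weak $V$-module $M$ (linear $Y_M$ with $Y_M(a,z)w\in M((z))$, $Y_M(\mathbf 1,z)=\mathrm{id}$, and the Jacobi identity) with a grading $M=M(0)\oplus\bigoplus_{\operatorname{Re}\mu>0}M(\mu)$ such that $M(0)\ne0$ and $a(n)M(\mu)\subseteq M(\mu+\lambda-n-1)$ for $a\in V_\lambda$. Morphisms of admissible modules are the linear maps commuting with all modes $a(n)$. For $a\in V_\mu$ put $|a|=\mu$,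 $\tilde a=\lceil\operatorname{Re}\mu\rceil$, and $\delta=1$ if $|a|=\tilde a$, $\delta=0$ otherwise. Define, extending linearly in $a$, $$a\circ b=\operatorname{Res}_z\frac{(1+z)^{\tilde a+\delta-1}}{z^{1+\delta}}Y(a,z)b,\qquad a\star b=\delta\operatorname{Res}_z\frac{(1+z)^{|a|}}{z}Y(a,z)b,\qquad o(a)=a(\tilde a-1).$$ Let $O(V)$ be the linear span of all $a\circ b$ with $a,b\in V$, let $A(V)=V/O(V)$, and for an admissible $V$-module $M$ let $\Omega(M)$ be the linear span of the lowest weight vectors of $M$. Theorem. Let $V$ be a $\mathbb C$-graded vertex algebra. The product $\star$ induces on $A(V)$ the structure of an associative $\mathbb C$-algebra with unit the class of $\mathbf 1$. For every admissible $V$-module $M$, $O(V)$ annihilates $\Omega(M)$ through zero modes, i.e. $o(u)w=0$ for $u\in O(V)$ and $w\in\Omega(M)$; moreover $o(a\star b)w=o(a)o(b)w$ for all $a,b\in V$ and $w\in\Omega(M)$; and $\Omega(M)$ is a (unital) $A(V)$-module in which the class of $a\in V$ acts as $o(a)$. The lowest weight space $M(0)$ is contained in $\Omega(M)$ and is an $A(V)$-submodule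 of it. The assignment $M\mapsto\Omega(M)$, $f\mapsto f|_{\Omega(M)}$ is a functor from the category of admissible $V$-modules to the category of $A(V)$-modules. -/

import Mathlib

open CategoryTheory

universe u w

noncomputable section

namespace VA

section Modes

variable {V : Type*} [AddCommGroup V] [Module ℂ V]
variable {M : Type*} [AddCommGroup M] [Module ℂ M]

/-- The mode `a(n)`, where `Y(a,z) = ∑ a(n) z^(-n-1)`. A `VertexOperator ℂ M` is a linear map from
`M` to `M((z))`, so the truncation condition `a(n)w = 0` for `n ≫ 0` is part of the type. -/
def mode (Y : V →ₗ[ℂ] VertexOperator ℂ M) (a : V) (n : ℤ) : Module.End ℂ M :=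
  VertexOperator.ncoeff (Y a) n

/-- The Jacobi identity for `Y_M`, in terms of modes (the Borcherds identity). All sums are finite
by truncation. -/
def JacobiIdentity (Y : V →ₗ[ℂ] VertexOperator ℂ V) (YM : V →ₗ[ℂ] VertexOperator ℂ M) : Prop :=
  ∀ (a b : V) (w : M) (m n k : ℤ),
    ∑ᶠ i : ℕ, Ring.choose m i • mode YM (mode Y a (n + i) b) (m + k - i) w =
      ∑ᶠ j : ℕ, ((-1) ^ j * Ring.choose n j) •
        (mode YM a (m + n - j) (mode YM b (k + j) w) -
          (n.negOnePow : ℤ) • mode YM b (n + k - j) (mode YM a (m + j) w))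

/-- Lowest weight vectors: homogeneous vectors `w` (with respect to the grading `𝒢`) such that for
any homogeneous `a` of weight `lam` in `V`, if `a(n)w ≠ 0` then `n = lam - 1` or
`n < Re lam - 1`. -/
def IsLowestWeight (𝒱 : ℂ → Submodule ℂ V) (YM : V →ₗ[ℂ] VertexOperator ℂ M)
    (𝒢 : ℂ → Submodule ℂ M) (w : M) : Prop :=
  (∃ μ, w ∈ 𝒢 μ) ∧
    ∀ (lam : ℂ) (a : V) (n : ℤ), a ∈ 𝒱 lam → mode YM a n w ≠ 0 →
      (n : ℂ) = lam - 1 ∨ (n : ℝ) < lam.re - 1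

theorem mode_add (Y : V →ₗ[ℂ] VertexOperator ℂ M) (a b : V) (n : ℤ) :
    mode Y (a + b) n = mode Y a n + mode Y b n := by
  simp [mode]

theorem mode_smul (Y : V →ₗ[ℂ] VertexOperator ℂ M) (c : ℂ) (a : V) (n : ℤ) :
    mode Y (c • a) n = c • mode Y a n := by
  simp [mode]

theorem finite_modes (Y : V →ₗ[ℂ] VertexOperator ℂ M) (p q : ℤ) (a : V) (w : M) :
    (Function.support fun i : ℕ => Ring.choose p i • mode Y a (i - q) w).Finite := by
  refine (Set.finite_lt_nat
    ((q - HahnSeries.order ((HahnModule.of ℂ).symm (Y a w))).toNat)).subset fun i hi => ?_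
  by_contra h
  refine hi ?_
  have h0 : mode Y a (i - q) w = 0 := by
    refine VertexOperator.ncoeff_eq_zero_of_lt_order _ _ _ ?_
    simp only [Set.mem_ofPred_eq, not_lt] at h
    omega
  simp [h0]

/-- `Res_z ((1+z)^p / z^q) Y(a,z)w = ∑ i, (p choose i) a(i-q)w`, with `(1+z)^p` expanded in
nonnegative powers of `z`. -/
def resProd (Y : V →ₗ[ℂ] VertexOperator ℂ M) (p q : ℤ) : V →ₗ[ℂ] M →ₗ[ℂ] M :=
  LinearMap.mk₂ ℂ (fun a w => ∑ᶠ i : ℕ, Ring.choose p i • mode Y a (i - q) w)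
    (fun a b w => by
      rw [← finsum_add_distrib (finite_modes Y p q a w) (finite_modes Y p q b w)]
      simp [mode_add])
    (fun c a w => by
      rw [smul_finsum' c (finite_modes Y p q a w)]
      simp [mode_smul, smul_comm c])
    (fun a v w => by
      rw [← finsum_add_distrib (finite_modes Y p q a v) (finite_modes Y p q a w)]
      simp)
    (fun c a w => by
      rw [smul_finsum' c (finite_modes Y p q a w)]
      simp [smul_comm c])

end Modes

/-- A vertex algebra `(V, Y, 𝟏, T)` over `ℂ`. -/
class VertexAlgebra (V : Type u) [AddCommGroup V] [Module ℂ V] where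
  Y : V →ₗ[ℂ] VertexOperator ℂ V
  vac : V
  T : Module.End ℂ V
  vac_mode : ∀ (n : ℤ) (b : V), mode Y vac n b = if n = -1 then b else 0
  mode_vac_of_nonneg : ∀ (a : V) (n : ℤ), 0 ≤ n → mode Y a n vac = 0
  mode_neg_one_vac : ∀ a : V, mode Y a (-1) vac = a
  T_commutator : ∀ (a b : V) (n : ℤ),
    T (mode Y a n b) - mode Y a n (T b) = (-n) • mode Y a (n - 1) b
  T_mode : ∀ (a b : V) (n : ℤ), mode Y (T a) n b = (-n) • mode Y a (n - 1) b
  jacobi : JacobiIdentity Y Y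

/-- A `ℂ`-graded vertex algebra: a vertex algebra with a `ℂ`-grading by weights which is generated,
as a module over itself, by lowest weight vectors. -/
class CGradedVertexAlgebra (V : Type u) [AddCommGroup V] [Module ℂ V] extends
    VertexAlgebra V where
  wt : ℂ → Submodule ℂ V
  isInternal : DirectSum.IsInternal wt
  mode_mem : ∀ (lam μ : ℂ) (a b : V) (n : ℤ), a ∈ wt lam → b ∈ wt μ →
    mode Y a n b ∈ wt (μ + lam - n - 1)
  generated : ∀ W : Submodule ℂ V,
    (∀ v, IsLowestWeight wt Y wt v → v ∈ W) →
    (∀ (a : V) (n : ℤ), ∀ v ∈ W, mode Y a n v ∈ W) → W = ⊤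

section Zhu

variable (V : Type u) [AddCommGroup V] [Module ℂ V] [CGradedVertexAlgebra V]

theorem wt_bijective :
    Function.Bijective (DirectSum.coeLinearMap (CGradedVertexAlgebra.wt (V := V))) :=
  CGradedVertexAlgebra.isInternal

/-- The linear map on `V` which agrees with `f μ` on the vectors of weight `μ`. -/
def linExt {W : Type*} [AddCommGroup W] [Module ℂ W] (f : ℂ → V →ₗ[ℂ] W) : V →ₗ[ℂ] W :=
  DirectSum.toModule ℂ ℂ W
      (fun μ => f μ ∘ₗ (CGradedVertexAlgebra.wt (V := V) μ).subtype) ∘ₗ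
    (LinearEquiv.ofBijective (DirectSum.coeLinearMap (CGradedVertexAlgebra.wt (V := V)))
      (wt_bijective V)).symm.toLinearMap

/-- `δ_{r,0}` for `r = μ - ⌈Re μ⌉`. -/
def delta (μ : ℂ) : ℤ := open Classical in if μ - (⌈μ.re⌉ : ℂ) = 0 then 1 else 0

/-- `a ∘ b`, the linear extension of `Res_z ((1+z)^(⌈Re|a|⌉ + δ - 1) / z^(1+δ)) Y(a,z)b`. -/
def circ : V →ₗ[ℂ] V →ₗ[ℂ] V :=
  linExt V fun μ => resProd VertexAlgebra.Y (⌈μ.re⌉ + delta μ - 1) (1 + delta μ)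

/-- `a ⋆ b`, the linear extension of `δ Res_z ((1+z)^|a| / z) Y(a,z)b`; when `δ ≠ 0` one has
`|a| = ⌈Re|a|⌉`. -/
def star : V →ₗ[ℂ] V →ₗ[ℂ] V :=
  linExt V fun μ => delta μ • resProd VertexAlgebra.Y ⌈μ.re⌉ 1

/-- `O(V)`, the linear span of all `a ∘ b`. -/
def O : Submodule ℂ V := Submodule.span ℂ {x | ∃ a b : V, x = circ V a b}

/-- The underlying set of `A(V) = V / O(V)`. -/
def ZhuAlgebra : Type u := V ⧸ O V

/-- The quotient map `V → A(V)`. -/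
def toZhu (a : V) : ZhuAlgebra V := Submodule.Quotient.mk (p := O V) a

end Zhu

/-- An admissible module over a `ℂ`-graded vertex algebra `V`: a weak `V`-module with a grading by
`{0} ∪ {μ | 0 < Re μ}` (written as a grading by `ℂ` with the other components zero). -/
structure AdmissibleModule (V : Type u) [AddCommGroup V] [Module ℂ V]
    [CGradedVertexAlgebra V] where
  carrier : Type w
  [addCommGroup : AddCommGroup carrier]
  [module : Module ℂ carrier]
  YM : V →ₗ[ℂ] VertexOperator ℂ carrier
  vac_mode : ∀ (n : ℤ) (x : carrier),
    mode YM VertexAlgebra.vac n x = if n = -1 then x else 0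
  jacobi : JacobiIdentity VertexAlgebra.Y YM
  gr : ℂ → Submodule ℂ carrier
  isInternal : DirectSum.IsInternal gr
  gr_eq_bot : ∀ μ : ℂ, μ ≠ 0 → μ.re ≤ 0 → gr μ = ⊥
  gr_zero_ne_bot : gr 0 ≠ ⊥
  mode_mem : ∀ (lam μ : ℂ) (a : V) (x : carrier) (n : ℤ),
    a ∈ CGradedVertexAlgebra.wt lam → x ∈ gr μ → mode YM a n x ∈ gr (μ + lam - n - 1)

namespace AdmissibleModule

variable {V : Type u} [AddCommGroup V] [Module ℂ V] [CGradedVertexAlgebra V]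

attribute [instance] AdmissibleModule.addCommGroup AdmissibleModule.module

/-- Homomorphisms of admissible modules: linear maps that commute with all modes `a(n)`. -/
@[ext]
structure Hom (M N : AdmissibleModule.{u, w} V) where
  toLinearMap : M.carrier →ₗ[ℂ] N.carrier
  map_mode : ∀ (a : V) (n : ℤ) (x : M.carrier),
    toLinearMap (mode M.YM a n x) = mode N.YM a n (toLinearMap x)

instance : Category (AdmissibleModule.{u, w} V) where
  Hom M N := Hom M N
  id M := ⟨LinearMap.id, fun _ _ _ => rfl⟩
  comp f g := ⟨g.toLinearMap ∘ₗ f.toLinearMap, fun a n x => by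
    simp [f.map_mode, g.map_mode]⟩

/-- The linear map underlying a morphism. -/
def homMap {M N : AdmissibleModule.{u, w} V} (f : M ⟶ N) : M.carrier →ₗ[ℂ] N.carrier :=
  Hom.toLinearMap f

/-- The zero mode `o(a)` acting on `M`: the linear extension in `a` of `a(⌈Re|a|⌉ - 1)`. -/
def zeroMode (M : AdmissibleModule.{u, w} V) : V →ₗ[ℂ] Module.End ℂ M.carrier :=
  linExt V fun μ =>
    { toFun := fun a => mode M.YM a (⌈μ.re⌉ - 1)
      map_add' := fun a b => mode_add M.YM a b _
      map_smul' := fun c a => mode_smul M.YM c a _ }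

/-- The vacuum space `Ω(M)`: the space of lowest weight vectors of `M`. Lowest weight vectors are
homogeneous by definition, so this is the span of them. -/
def vacuumSpace (M : AdmissibleModule.{u, w} V) : Submodule ℂ M.carrier :=
  Submodule.span ℂ {x | IsLowestWeight CGradedVertexAlgebra.wt M.YM M.gr x}

end AdmissibleModule

end VA

end

/-!
The proof follows Zhu. Write `Y_{p,q}(a)b = Res ((1+z)^p / z^q) Y(a,z)b` (`resProd`), so that
`a ∘ b` and `a ⋆ b` are values of these products on homogeneous `a`.

Multiplying the Jacobi identity by `(1+z)^p (1+w)^q` gives an identity between iterates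
`Y_{*,*}(a(n)b)c` and products `Y_{*,*}(a)Y_{*,*}(b)c`, `Y_{*,*}(b)Y_{*,*}(a)c`
(`exists_resProd_identity`). Integration by parts against `Y(Ta,z)` shows that raising the exponent
`p` by `m` and the pole order `q` by `n ≥ m` in the definition of `a ∘ b` gives elements of `O(V)`
(`resProd_mem_O`). In the two-variable identities for `(a ∘ b) ⋆ c`, for
`c ⋆ (a ∘ b) - a ∘ (c ⋆ b)` and for `(a ⋆ b) ⋆ c - a ⋆ (b ⋆ c)`, all terms are of this form, so
`O(V)` is a two-sided ideal and `⋆` is associative modulo `O(V)`.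

There is one exception, `(a ∘ b) ⋆ c` for nonintegral weights of `a` and `b` with integral real part
and integral sum. There `⌈Re|a|⌉ + ⌈Re|b|⌉` is `|a| + |b|` rather than `|a| + |b| + 1`, and the
exponent of `1 + w` is too large by one in a single term. That term is in `O(V)` because
`a ∘ b` and `b ∘ a` both are, and skew-symmetry modulo `O(V)`
(`resProd_sub_resProd_swap_mem_O`, the two-variable identity on the vacuum) relates them to each
other with exponents that differ by one (`resProd_zero_mem_O`).

On the module side, `Ω(M)` is the space of all vectors, homogeneous or not, killed by the modes
`a(n)` with `n ≥ Re|a| - 1` and `n ≠ |a| - 1` (`vacuumSpace_eq_annihilated`), because these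
conditions pass to homogeneous components. In this form `Ω(M)` is visibly preserved by morphisms,
which need not be graded. In the Jacobi identity for `o(a ∘ b)w` with `w ∈ Ω(M)`, every term on the
right side contains such a mode acting on `w`, and in the one for `o(a ⋆ b)w` only `o(a)o(b)w`
remains. Vectors of nonintegral weight lie in `O(V)` (`mem_O_of_delta_eq_zero`) and their zero modes
vanish on `Ω(M)`, so these identities are needed only when the total weight is integral.
-/

noncomputable section

namespace VA

/-! ### Binomial identities -/

open Finset in
theorem sum_antidiagonal_choose_mul_choose_mul_choose (p q : ℤ) (s u : ℕ) :
    ∑ y ∈ antidiagonal u, Ring.choose p y.1 * Ring.choose q y.2 * (y.1.choose s : ℤ) =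
      Ring.choose p s * if s ≤ u then Ring.choose (p + q - s) (u - s) else 0 := by
  rw [Nat.sum_antidiagonal_eq_sum_range_succ
    (fun i j => Ring.choose p i * Ring.choose q j * (i.choose s : ℤ)) u]
  split_ifs with h
  · obtain ⟨v, rfl⟩ := Nat.exists_eq_add_of_le h
    rw [Nat.succ_eq_add_one, add_assoc, sum_range_add, sum_eq_zero, zero_add,
      Nat.add_sub_cancel_left, show p + q - s = (p - s) + q by ring,
      Ring.add_choose_eq _ (Commute.all _ _),
      Nat.sum_antidiagonal_eq_sum_range_succ
        (fun i j => Ring.choose (p - s) i * Ring.choose q j) v, mul_sum]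
    · refine sum_congr rfl fun i _ => ?_
      have := Ring.choose_smul_choose p (Nat.le_add_right s i)
      rw [Nat.add_sub_cancel_left, nsmul_eq_mul] at this
      rw [Nat.add_sub_add_left]
      linear_combination Ring.choose q (v - i) * this
    · intro i hi
      simp [Nat.choose_eq_zero_of_lt (mem_range.1 hi)]
  · rw [mul_zero]
    refine sum_eq_zero fun i hi => ?_
    have : i < s := by have := mem_range.1 hi; omega
    simp [Nat.choose_eq_zero_of_lt this]

open Finset in
/-- The coefficient of `w ^ (m - l + u) * x ^ l` in `(1 + z) ^ p * (1 + w) ^ q * z ^ m` with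
`z = w + x`, computed in two ways. -/
theorem sum_antidiagonal_choose_expand (p q m : ℤ) (l u : ℕ) :
    ∑ x ∈ antidiagonal l, Ring.choose p x.1 * Ring.choose m x.2 *
        (if x.1 ≤ u then Ring.choose (p + q - x.1) (u - x.1) else 0) =
      ∑ y ∈ antidiagonal u, Ring.choose p y.1 * Ring.choose q y.2 * Ring.choose (m + y.1) l := by
  have h (i : ℕ) : Ring.choose (m + i) l =
      ∑ x ∈ antidiagonal l, (i.choose x.1 : ℤ) * Ring.choose m x.2 := by
    rw [add_comm, Ring.add_choose_eq _ (Commute.all _ _)]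
    simp [Ring.choose_natCast]
  simp_rw [h, mul_sum]
  rw [sum_comm]
  refine sum_congr rfl fun x _ => ?_
  rw [mul_right_comm, ← sum_antidiagonal_choose_mul_choose_mul_choose, sum_mul]
  exact sum_congr rfl fun y _ => by ring

section Sums

variable {A : Type*} [AddCommGroup A]

open Finset in
theorem sum_range_sum_range_eq_sum_antidiagonal (f : ℕ → ℕ → A) (B : ℕ)
    (hf : ∀ i j, B ≤ i + j → f i j = 0) :
    ∑ i ∈ range B, ∑ j ∈ range B, f i j =
      ∑ u ∈ range B, ∑ y ∈ antidiagonal u, f y.1 y.2 := by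
  rw [← sum_product', sum_sigma']
  symm
  refine sum_of_injOn (fun x => x.2) ?_ ?_ ?_ ?_
  · rintro ⟨u, y⟩ hx ⟨u', y'⟩ hx' h
    simp only [coe_sigma, Set.mem_sigma_iff, mem_coe, HasAntidiagonal.mem_antidiagonal] at hx hx' h
    subst h
    obtain rfl : u = u' := hx.2.symm.trans hx'.2
    rfl
  · rintro ⟨u, y⟩ hx
    simp only [coe_sigma, Set.mem_sigma_iff, mem_coe, HasAntidiagonal.mem_antidiagonal,
      mem_range] at hx
    simp only [coe_product, Set.mem_prod, mem_coe, mem_range]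
    omega
  · rintro ⟨i, j⟩ hx hx'
    refine hf i j ?_
    by_contra h
    exact hx' ⟨⟨i + j, (i, j)⟩, by simpa using h, rfl⟩
  · intros; rfl

open Finset in
theorem sum_range_shift (g : ℕ → ℤ) (X : ℕ → A) (s B : ℕ) (hX : ∀ u, B ≤ u → X u = 0) :
    ∑ r ∈ range B, g r • X (r + s) =
      ∑ u ∈ range B, (if s ≤ u then g (u - s) else 0) • X u := by
  have h1 : ∑ u ∈ range (s + B), (if s ≤ u then g (u - s) else 0) • X u =
      ∑ r ∈ range B, g r • X (r + s) := by
    rw [sum_range_add, sum_eq_zero, zero_add]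
    · exact sum_congr rfl fun r _ => by simp [add_comm]
    · intro u hu
      simp [(mem_range.1 hu).not_ge]
  rw [← h1]
  symm
  refine sum_subset (range_mono (Nat.le_add_left _ _)) fun u _ hu => ?_
  rw [hX u (by simpa using hu), smul_zero]

open Finset in
/-- `sum_antidiagonal_choose_expand` paired with a finite sequence `X` of vectors. -/
theorem sum_choose_expand (p q m : ℤ) (l B : ℕ) (X : ℕ → A) (hX : ∀ u, B ≤ u → X u = 0) :
    ∑ x ∈ antidiagonal l, (Ring.choose p x.1 * Ring.choose m x.2) •
        ∑ r ∈ range B, Ring.choose (p + q - x.1) r • X (r + x.1) =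
      ∑ i ∈ range B, ∑ j ∈ range B,
        (Ring.choose p i * Ring.choose q j * Ring.choose (m + i) l) • X (i + j) := by
  rw [sum_range_sum_range_eq_sum_antidiagonal
    (fun i j => (Ring.choose p i * Ring.choose q j * Ring.choose (m + i) l) • X (i + j)) B
    fun i j h => by rw [hX _ h, smul_zero]]
  simp_rw [sum_range_shift (fun r => Ring.choose _ r) X _ B hX, smul_sum, smul_smul]
  rw [sum_comm]
  refine sum_congr rfl fun u _ => ?_
  rw [← sum_smul, sum_antidiagonal_choose_expand, sum_smul]
  exact sum_congr rfl fun y hy => by rw [mem_antidiagonal.1 hy]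

end Sums

/-! ### Residue products -/

section Modes

variable {V : Type*} [AddCommGroup V] [Module ℂ V]
variable {M : Type*} [AddCommGroup M] [Module ℂ M]

theorem exists_mode_eq_zero (Y : V →ₗ[ℂ] VertexOperator ℂ M) (a : V) (w : M) :
    ∃ N : ℤ, ∀ n, N ≤ n → mode Y a n w = 0 :=
  ⟨-((HahnModule.of ℂ).symm (Y a w)).order, fun n hn =>
    VertexOperator.ncoeff_eq_zero_of_lt_order _ _ _ (by omega)⟩

theorem eventually_mode_add_eq_zero (Y : V →ₗ[ℂ] VertexOperator ℂ M) (a : V) (w : M) (n : ℤ) :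
    ∀ᶠ i : ℕ in Filter.atTop, mode Y a (n + i) w = 0 := by
  obtain ⟨N, hN⟩ := exists_mode_eq_zero Y a w
  filter_upwards [Filter.eventually_ge_atTop (N - n).toNat] with i hi
  exact hN _ (by omega)

theorem finsum_eq_sum_range {A : Type*} [AddCommGroup A] (f : ℕ → A) (B : ℕ)
    (hf : ∀ i, B ≤ i → f i = 0) : ∑ᶠ i, f i = ∑ i ∈ Finset.range B, f i :=
  finsum_eq_sum_of_support_subset _ fun i hi => by
    by_contra h
    exact hi (hf i (by simpa using h))

theorem resProd_eq_sum_range (Y : V →ₗ[ℂ] VertexOperator ℂ M) (p q : ℤ) (a : V) (w : M) (B : ℕ)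
    (h : ∀ i : ℕ, B ≤ i → mode Y a (i - q) w = 0) :
    resProd Y p q a w = ∑ i ∈ Finset.range B, Ring.choose p i • mode Y a (i - q) w :=
  finsum_eq_sum_range _ B fun i hi => by rw [h i hi, smul_zero]

theorem resProd_mem (Y : V →ₗ[ℂ] VertexOperator ℂ M) (p q : ℤ) (a : V) (w : M)
    (S : Submodule ℂ M) (h : ∀ i : ℕ, mode Y a (i - q) w ∈ S) : resProd Y p q a w ∈ S := by
  refine finsum_induction (· ∈ S) S.zero_mem (fun _ _ => S.add_mem) fun i => ?_
  exact S.toAddSubgroup.zsmul_mem (h i) _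

open Finset in
/-- `(1 + z) ^ (p + 1) * z ^ (-q) = (1 + z) ^ p * z ^ (-q) + (1 + z) ^ p * z ^ (-(q - 1))`. -/
theorem resProd_add_one (Y : V →ₗ[ℂ] VertexOperator ℂ M) (p q : ℤ) (a : V) (w : M) :
    resProd Y (p + 1) q a w = resProd Y p q a w + resProd Y p (q - 1) a w := by
  obtain ⟨B, hB⟩ := (eventually_mode_add_eq_zero Y a w (-q)).exists_forall_of_atTop
  have h0 (i : ℕ) (hi : B ≤ i) : mode Y a (i - q) w = 0 := by
    rw [sub_eq_add_neg, add_comm]; exact hB i hi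
  rw [resProd_eq_sum_range Y (p + 1) q a w (B + 1), resProd_eq_sum_range Y p q a w (B + 1),
    resProd_eq_sum_range Y p (q - 1) a w B, sum_range_succ', sum_range_succ']
  · simp only [Ring.choose_succ_succ, add_smul, sum_add_distrib, Ring.choose_zero_right]
    have (i : ℕ) : ((i + 1 : ℕ) : ℤ) - q = i - (q - 1) := by push_cast; ring
    simp only [this]
    abel
  all_goals intro i hi
  · rw [show (i : ℤ) - (q - 1) = (i + 1 : ℕ) - q by push_cast; ring]
    exact h0 (i + 1) (by omega)
  · exact h0 i (by omega)
  · exact h0 i (by omega)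

open Finset in
/-- Integrating by parts: if `Y(a',z)` is the derivative of `Y(a,z)`, then
`Res f Y(a',z) = -Res f' Y(a,z)`. -/
theorem resProd_of_derivative (Y : V →ₗ[ℂ] VertexOperator ℂ M) (a a' : V)
    (h : ∀ (n : ℤ) (w : M), mode Y a' n w = (-n) • mode Y a (n - 1) w) (p q : ℤ) (w : M) :
    resProd Y p q a' w = q • resProd Y p (q + 1) a w - p • resProd Y (p - 1) q a w := by
  obtain ⟨B, hB⟩ := (eventually_mode_add_eq_zero Y a w (-(q + 1))).exists_forall_of_atTop
  have h0 (i : ℕ) (hi : B ≤ i) : mode Y a (i - (q + 1)) w = 0 := by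
    rw [sub_eq_add_neg, add_comm]; exact hB i hi
  have e (i : ℕ) : (i : ℤ) - q - 1 = i - (q + 1) := by ring
  rw [resProd_eq_sum_range Y p q a' w (B + 1), resProd_eq_sum_range Y p (q + 1) a w (B + 1),
    resProd_eq_sum_range Y (p - 1) q a w B, smul_sum, smul_sum]
  · have hc (i : ℕ) : Ring.choose p (i + 1) * ((i : ℤ) + 1) = p * Ring.choose (p - 1) i := by
      have := Ring.choose_smul_choose p (Nat.le_add_left 1 i)
      simp only [Nat.choose_one_right, nsmul_eq_mul, Ring.choose_one_right,
        Nat.add_sub_cancel] at this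
      push_cast at this
      linear_combination this
    rw [sum_range_succ', sum_range_succ' _ B]
    simp only [h, e, smul_smul]
    rw [add_sub_right_comm, ← sum_sub_distrib]
    congr 1
    · refine sum_congr rfl fun i _ => ?_
      have : ((i + 1 : ℕ) : ℤ) - (q + 1) = i - q := by push_cast; ring
      rw [this, ← sub_smul]
      congr 1
      push_cast
      linear_combination -(hc i)
    · simp
  · intro i hi
    have := h0 (i + 1) (by omega)
    have e' : ((i + 1 : ℕ) : ℤ) - (q + 1) = i - q := by push_cast; ring
    rwa [e'] at this
  · exact fun i hi => h0 i (by omega)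
  · intro i hi
    rw [h, e, h0 i (by omega), smul_zero]

/-! ### The two-variable identity -/

open Finset in
/-- The Jacobi identity multiplied by `(1 + z) ^ p * (1 + w) ^ q * z ^ m * w ^ k * (z - w) ^ n`, the
binomials in `z` and `w` being expanded in nonnegative powers. The sums are cut off at a common
bound, beyond which `a(n + l) b` vanishes. -/
theorem exists_resProd_identity {Y : V →ₗ[ℂ] VertexOperator ℂ V}
    {YM : V →ₗ[ℂ] VertexOperator ℂ M} (hJ : JacobiIdentity Y YM) (p q m n k : ℤ) (a b : V)
    (c : M) :
    ∃ B : ℕ, 0 < B ∧ (∀ l : ℕ, B ≤ l → mode Y a (n + l) b = 0) ∧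
      ∑ l ∈ range B, ∑ x ∈ antidiagonal l, (Ring.choose p x.1 * Ring.choose m x.2) •
          resProd YM (p + q - x.1) (x.2 - m - k) (mode Y a (n + l) b) c =
        ∑ t ∈ range B, ((-1) ^ t * Ring.choose n t) •
          (resProd YM p (t - m - n) a (resProd YM q (-k - t) b c) -
            (n.negOnePow : ℤ) • resProd YM q (t - n - k) b (resProd YM p (-m - t) a c)) := by
  obtain ⟨B₁, hB₁⟩ := ((eventually_mode_add_eq_zero Y a b n).and
    ((eventually_mode_add_eq_zero YM b c k).and
      (eventually_mode_add_eq_zero YM a c m))).exists_forall_of_atTop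
  have ev : ∀ᶠ i : ℕ in Filter.atTop, ∀ l ∈ range B₁,
      mode YM (mode Y a (n + l) b) (m + k - l + i) c = 0 ∧
      ∀ t ∈ range B₁, mode YM a (m + n - t + i) (mode YM b (k + l) c) = 0 ∧
        mode YM b (n + k - t + i) (mode YM a (m + l) c) = 0 := by
    rw [Filter.eventually_all_finset]
    intro l _
    refine (eventually_mode_add_eq_zero _ _ _ _).and ?_
    rw [Filter.eventually_all_finset]
    intro t _
    exact (eventually_mode_add_eq_zero _ _ _ _).and (eventually_mode_add_eq_zero _ _ _ _)
  obtain ⟨B₂, hB₂⟩ := ev.exists_forall_of_atTop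
  obtain ⟨B, hB, hBB⟩ : ∃ B, B₁ ≤ B ∧ B₂ ≤ B ∧ 0 < B :=
    ⟨B₁ + B₂ + 1, by omega, by omega, by omega⟩
  have hab (l : ℕ) (hl : B ≤ l) : mode Y a (n + l) b = 0 := (hB₁ l (by omega)).1
  have hbc (l : ℕ) (hl : B ≤ l) : mode YM b (k + l) c = 0 := (hB₁ l (by omega)).2.1
  have hac (l : ℕ) (hl : B ≤ l) : mode YM a (m + l) c = 0 := (hB₁ l (by omega)).2.2
  have h1 (l u : ℕ) (hu : B ≤ u) : mode YM (mode Y a (n + l) b) (m + k - l + u) c = 0 := by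
    by_cases hl : l < B₁
    · exact (hB₂ u (by omega) l (mem_range.2 hl)).1
    · rw [(hB₁ l (by omega)).1]; simp [mode]
  have h2 (l t u : ℕ) (ht : t ≤ l) (hu : B ≤ u) :
      mode YM a (m + n - t + u) (mode YM b (k + l) c) = 0 := by
    by_cases hl : l < B₁
    · exact ((hB₂ u (by omega) l (mem_range.2 hl)).2 t (mem_range.2 (by omega))).1
    · rw [(hB₁ l (by omega)).2.1, map_zero]
  have h3 (l t u : ℕ) (ht : t ≤ l) (hu : B ≤ u) :
      mode YM b (n + k - t + u) (mode YM a (m + l) c) = 0 := by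
    by_cases hl : l < B₁
    · exact ((hB₂ u (by omega) l (mem_range.2 hl)).2 t (mem_range.2 (by omega))).2
    · rw [(hB₁ l (by omega)).2.2, map_zero]
  refine ⟨B, hBB.2, hab, ?_⟩
  -- Both sides equal this sum, by the Jacobi identity for the exponents `m + i`, `n`, `k + j`.
  have key (i j : ℕ) :
      ∑ l ∈ range B, Ring.choose (m + i) l •
          mode YM (mode Y a (n + l) b) (m + k - l + (i + j : ℕ)) c =
        ∑ t ∈ range B, ((-1) ^ t * Ring.choose n t) •
          (mode YM a (m + n - t + i) (mode YM b (k + (j + t : ℕ)) c) -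
            (n.negOnePow : ℤ) • mode YM b (n + k - t + j) (mode YM a (m + (i + t : ℕ)) c)) := by
    have := hJ a b c (m + i) n (k + j)
    rw [finsum_eq_sum_range _ B, finsum_eq_sum_range _ B] at this
    · convert this using 6 <;> push_cast <;> ring_nf
    · intro t ht
      have e1 : k + j + t = k + (j + t : ℕ) := by push_cast; ring
      have e2 : m + i + t = m + (i + t : ℕ) := by push_cast; ring
      rw [e1, e2, hbc _ (by omega), hac _ (by omega)]
      simp
    · intro l hl
      rw [hab l hl]; simp [mode]
  have lhs (l : ℕ) :
      ∑ x ∈ antidiagonal l, (Ring.choose p x.1 * Ring.choose m x.2) •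
          resProd YM (p + q - x.1) (x.2 - m - k) (mode Y a (n + l) b) c =
        ∑ i ∈ range B, ∑ j ∈ range B,
          (Ring.choose p i * Ring.choose q j * Ring.choose (m + i) l) •
            mode YM (mode Y a (n + l) b) (m + k - l + (i + j : ℕ)) c := by
    rw [← sum_choose_expand p q m l B
      (fun u => mode YM (mode Y a (n + l) b) (m + k - l + u) c) (h1 l)]
    refine sum_congr rfl fun x hx => ?_
    have e (i : ℕ) : (i : ℤ) - (x.2 - m - k) = m + k - l + (i + x.1 : ℕ) := by
      rw [← mem_antidiagonal.1 hx]; push_cast; ring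
    rw [resProd_eq_sum_range _ _ _ _ _ B]
    · simp only [e]
    · intro i hi
      rw [e, h1 _ _ (by omega)]
  have rhs1 (t : ℕ) : resProd YM p (t - m - n) a (resProd YM q (-k - t) b c) =
      ∑ i ∈ range B, ∑ j ∈ range B, (Ring.choose p i * Ring.choose q j) •
        mode YM a (m + n - t + i) (mode YM b (k + (j + t : ℕ)) c) := by
    have e (j : ℕ) : (j : ℤ) - (-k - t) = k + (j + t : ℕ) := by push_cast; ring
    have e' (i : ℕ) : (i : ℤ) - (t - m - n) = m + n - t + i := by ring
    rw [resProd_eq_sum_range YM q _ b c B, resProd_eq_sum_range YM p _ a _ B]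
    · simp only [map_sum, map_zsmul, smul_sum, smul_smul, e, e']
    · intro i hi
      simp only [map_sum, map_zsmul, e, e']
      exact sum_eq_zero fun j _ => by rw [h2 _ _ _ (by omega) hi, smul_zero]
    · intro j hj
      rw [e, hbc _ (by omega)]
  have rhs2 (t : ℕ) : resProd YM q (t - n - k) b (resProd YM p (-m - t) a c) =
      ∑ i ∈ range B, ∑ j ∈ range B, (Ring.choose p i * Ring.choose q j) •
        mode YM b (n + k - t + j) (mode YM a (m + (i + t : ℕ)) c) := by
    have e (j : ℕ) : (j : ℤ) - (-m - t) = m + (j + t : ℕ) := by push_cast; ring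
    have e' (i : ℕ) : (i : ℤ) - (t - n - k) = n + k - t + i := by ring
    rw [resProd_eq_sum_range YM p _ a c B, resProd_eq_sum_range YM q _ b _ B, sum_comm]
    · simp only [map_sum, map_zsmul, smul_sum, smul_smul, e, e', mul_comm]
    · intro i hi
      simp only [map_sum, map_zsmul, e, e']
      exact sum_eq_zero fun j _ => by rw [h3 _ _ _ (by omega) hi, smul_zero]
    · intro j hj
      rw [e, hac _ (by omega)]
  calc _ = ∑ i ∈ range B, ∑ j ∈ range B, (Ring.choose p i * Ring.choose q j) •
        ∑ l ∈ range B, Ring.choose (m + i) l •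
          mode YM (mode Y a (n + l) b) (m + k - l + (i + j : ℕ)) c := by
        simp_rw [lhs, smul_sum, smul_smul]
        rw [sum_comm]
        exact sum_congr rfl fun i _ => sum_comm
    _ = _ := by
        simp_rw [key, rhs1, rhs2, smul_sum, ← sum_sub_distrib, smul_sum]
        rw [sum_comm_cycle]
        refine sum_congr rfl fun t _ => sum_congr rfl fun i _ => sum_congr rfl fun j _ => ?_
        rw [smul_comm, smul_sub, smul_sub, smul_sub, smul_comm (n.negOnePow : ℤ)]

end Modes

/-! ### Weights -/

theorem delta_eq_zero_or_one (μ : ℂ) : delta μ = 0 ∨ delta μ = 1 := by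
  unfold delta; split_ifs <;> simp

theorem delta_eq_one_iff {μ : ℂ} : delta μ = 1 ↔ μ = (⌈μ.re⌉ : ℂ) := by
  rw [← sub_eq_zero (a := μ)]; unfold delta; split_ifs with h
  · exact iff_of_true rfl h
  · exact iff_of_false zero_ne_one h

theorem delta_intCast (N : ℤ) : delta (N : ℂ) = 1 := by
  rw [delta_eq_one_iff, Complex.intCast_re, Int.ceil_intCast]

theorem eq_intCast_of_delta_eq_one {μ : ℂ} (h : delta μ = 1) : ∃ N : ℤ, μ = N :=
  ⟨_, delta_eq_one_iff.1 h⟩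

theorem ceil_re_add_intCast (μ : ℂ) (N : ℤ) : ⌈(μ + N).re⌉ = ⌈μ.re⌉ + N := by
  simp

theorem delta_add_intCast (μ : ℂ) (N : ℤ) : delta (μ + N) = delta μ := by
  unfold delta
  rw [ceil_re_add_intCast]
  push_cast
  rw [add_sub_add_right_eq_sub]

theorem delta_intCast_add (μ : ℂ) (N : ℤ) : delta (N + μ) = delta μ := by
  rw [add_comm, delta_add_intCast]

section ModeLeft

variable {V : Type*} [AddCommGroup V] [Module ℂ V]
variable {M : Type*} [AddCommGroup M] [Module ℂ M]

/-- The mode `a(n)w` as a linear map in `a`. -/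
def modeLeft (Y : V →ₗ[ℂ] VertexOperator ℂ M) (n : ℤ) (w : M) : V →ₗ[ℂ] M where
  toFun a := mode Y a n w
  map_add' a b := by rw [mode_add]; rfl
  map_smul' c a := by rw [mode_smul]; rfl

@[simp]
theorem modeLeft_apply (Y : V →ₗ[ℂ] VertexOperator ℂ M) (n : ℤ) (w : M) (a : V) :
    modeLeft Y n w a = mode Y a n w := rfl

end ModeLeft

section Components

variable {M : Type*} [AddCommGroup M] [Module ℂ M] {𝒢 : ℂ → Submodule ℂ M}

theorem bijective_coeLinearMap (h : DirectSum.IsInternal 𝒢) :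
    Function.Bijective (DirectSum.coeLinearMap 𝒢) := h

/-- The projection of a graded vector space onto its component of weight `μ`. -/
def component (h : DirectSum.IsInternal 𝒢) (μ : ℂ) : M →ₗ[ℂ] M :=
  (𝒢 μ).subtype ∘ₗ DirectSum.component ℂ ℂ (fun i => 𝒢 i) μ ∘ₗ
    (LinearEquiv.ofBijective (DirectSum.coeLinearMap 𝒢)
      (bijective_coeLinearMap h)).symm.toLinearMap

theorem component_mem (h : DirectSum.IsInternal 𝒢) (μ : ℂ) (x : M) : component h μ x ∈ 𝒢 μ :=
  Submodule.coe_mem _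

theorem ofBijective_symm_of_mem (h : DirectSum.IsInternal 𝒢) {μ : ℂ} {x : M} (hx : x ∈ 𝒢 μ) :
    (LinearEquiv.ofBijective (DirectSum.coeLinearMap 𝒢)
      (bijective_coeLinearMap h)).symm x =
      DirectSum.lof ℂ ℂ (fun i => 𝒢 i) μ ⟨x, hx⟩ := by
  rw [LinearEquiv.symm_apply_eq]
  exact (DirectSum.coeLinearMap_lof 𝒢 μ ⟨x, hx⟩).symm

theorem component_of_mem (h : DirectSum.IsInternal 𝒢) {μ : ℂ} {x : M} (hx : x ∈ 𝒢 μ) :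
    component h μ x = x := by
  simp [component, ofBijective_symm_of_mem h hx, DirectSum.component.lof_self]

theorem component_of_mem_of_ne (h : DirectSum.IsInternal 𝒢) {μ ν : ℂ} {x : M} (hx : x ∈ 𝒢 μ)
    (hν : μ ≠ ν) : component h ν x = 0 := by
  simp [component, ofBijective_symm_of_mem h hx, DirectSum.component.of, hν]

theorem mem_of_component_mem (h : DirectSum.IsInternal 𝒢) (S : Submodule ℂ M) (x : M)
    (hx : ∀ μ, component h μ x ∈ S) : x ∈ S := by
  obtain ⟨y, rfl⟩ := (bijective_coeLinearMap h).surjective x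
  classical
  rw [DirectSum.coeLinearMap_eq_dfinsuppSum]
  refine S.sum_mem fun μ _ => ?_
  have e : (LinearEquiv.ofBijective (DirectSum.coeLinearMap 𝒢)
      (bijective_coeLinearMap h)).symm
      (DirectSum.coeLinearMap 𝒢 y) = y := LinearEquiv.symm_apply_apply _ _
  have := hx μ
  change (((LinearEquiv.ofBijective (DirectSum.coeLinearMap 𝒢)
      (bijective_coeLinearMap h)).symm
      (DirectSum.coeLinearMap 𝒢 y)) μ : M) ∈ S at this
  rwa [e] at this

theorem graded_induction (h : DirectSum.IsInternal 𝒢) {P : M → Prop} (hP : ∀ μ, ∀ a ∈ 𝒢 μ, P a)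
    (hadd : ∀ a b, P a → P b → P (a + b)) (a : M) : P a := by
  have ha : a ∈ ⨆ μ, 𝒢 μ := by rw [h.submodule_iSup_eq_top]; trivial
  exact Submodule.iSup_induction _ (motive := P) ha hP (hP 0 0 (zero_mem _)) hadd

/-- A linear map which raises weights by `d` commutes with taking components. -/
theorem component_map {N : Type*} [AddCommGroup N] [Module ℂ N] {ℋ : ℂ → Submodule ℂ N}
    (h : DirectSum.IsInternal 𝒢) (h' : DirectSum.IsInternal ℋ) (g : M →ₗ[ℂ] N) (d : ℂ)
    (hg : ∀ μ, ∀ x ∈ 𝒢 μ, g x ∈ ℋ (μ + d)) (μ : ℂ) (x : M) :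
    component h' (μ + d) (g x) = g (component h μ x) := by
  refine graded_induction h (P := fun x => component h' (μ + d) (g x) = g (component h μ x))
    (fun ν y hy => ?_) (fun y z hy hz => by simp only [map_add, hy, hz]) x
  by_cases hν : ν = μ
  · subst hν
    rw [component_of_mem h hy, component_of_mem h' (hg _ _ hy)]
  · rw [component_of_mem_of_ne h hy hν, component_of_mem_of_ne h' (hg _ _ hy) (by simpa using hν),
      map_zero]

end Components

section Graded

variable {V : Type u} [AddCommGroup V] [Module ℂ V] [CGradedVertexAlgebra V]

open VertexAlgebra CGradedVertexAlgebra

theorem linExt_of_mem {W : Type*} [AddCommGroup W] [Module ℂ W] (f : ℂ → V →ₗ[ℂ] W) {μ : ℂ}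
    {a : V} (ha : a ∈ wt μ) : linExt V f a = f μ a := by
  simp [linExt, ofBijective_symm_of_mem (isInternal (V := V)) ha]

/-- Every vector is a sum of homogeneous ones. -/
theorem wt_induction {P : V → Prop} (h : ∀ μ, ∀ a ∈ wt μ, P a)
    (hadd : ∀ a b, P a → P b → P (a + b)) (a : V) : P a :=
  graded_induction isInternal h hadd a

theorem circ_of_mem {μ : ℂ} {a : V} (ha : a ∈ wt μ) (b : V) :
    circ V a b = resProd Y (⌈μ.re⌉ + delta μ - 1) (1 + delta μ) a b := by
  rw [circ, linExt_of_mem _ ha]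

theorem star_of_mem {μ : ℂ} {a : V} (ha : a ∈ wt μ) (b : V) :
    star V a b = delta μ • resProd Y ⌈μ.re⌉ 1 a b := by
  rw [star, linExt_of_mem _ ha]; rfl

theorem star_of_delta_eq_zero {μ : ℂ} {a : V} (ha : a ∈ wt μ) (h : delta μ = 0) :
    star V a = 0 := by
  ext b; rw [star_of_mem ha, h, zero_smul]; rfl

theorem star_of_mem_intCast {N : ℤ} {a : V} (ha : a ∈ wt (N : ℂ)) (b : V) :
    star V a b = resProd Y N 1 a b := by
  rw [star_of_mem ha, delta_intCast, one_smul]; simp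

theorem circ_of_mem_intCast {N : ℤ} {a : V} (ha : a ∈ wt (N : ℂ)) (b : V) :
    circ V a b = resProd Y N 2 a b := by
  rw [circ_of_mem ha, delta_intCast]; simp

theorem circ_of_delta_eq_zero {μ : ℂ} {a : V} (ha : a ∈ wt μ) (h : delta μ = 0) (b : V) :
    circ V a b = resProd Y (⌈μ.re⌉ - 1) 1 a b := by
  rw [circ_of_mem ha, h]; simp

theorem circ_mem (a b : V) : circ V a b ∈ O V := Submodule.subset_span ⟨a, b, rfl⟩

theorem mode_mem' {lam μ ν : ℂ} {a b : V} {n : ℤ} (ha : a ∈ wt lam) (hb : b ∈ wt μ)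
    (h : ν = lam + μ - n - 1) : mode Y a n b ∈ wt (V := V) ν := by
  rw [h, add_comm lam]; exact mode_mem lam μ a b n ha hb

theorem resProd_one_vac (p : ℤ) (a : V) : resProd Y p 1 a vac = a := by
  rw [resProd_eq_sum_range _ _ _ _ _ 1]
  · simp [mode_neg_one_vac]
  · exact fun i hi => mode_vac_of_nonneg a _ (by omega)

theorem resProd_vac_of_nonpos (p q : ℤ) (hq : q ≤ 0) (a : V) : resProd Y p q a vac = 0 := by
  rw [resProd_eq_sum_range _ _ _ _ _ 0]
  · simp
  · exact fun i hi => mode_vac_of_nonneg a _ (by omega)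

theorem mem_O_of_delta_eq_zero {μ : ℂ} {a : V} (ha : a ∈ wt μ) (h : delta μ = 0) : a ∈ O V := by
  rw [← resProd_one_vac (⌈μ.re⌉ - 1) a, ← circ_of_delta_eq_zero ha h]
  exact circ_mem _ _

theorem vac_mem_wt_zero : (vac : V) ∈ wt (0 : ℂ) := by
  refine mem_of_component_mem isInternal _ _ fun μ => ?_
  by_cases hμ : μ = 0
  · exact hμ ▸ component_mem _ _ _
  -- The component `e` of `𝟏` of weight `μ ≠ 0` satisfies `e(-1) = 0`, because `𝟏(-1) = id`
  -- preserves weights; hence `e = e(-1)𝟏 = 0`.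
  have h (b : V) : mode Y (component isInternal μ (vac : V)) (-1) b = 0 := by
    refine wt_induction (P := fun b => mode Y (component isInternal μ (vac : V)) (-1) b = 0)
      (fun ν b hb => ?_) (fun b c hb hc => by rw [map_add, hb, hc, add_zero]) b
    have := component_map isInternal isInternal (modeLeft Y (-1) b) ν
      (fun lam a ha => mode_mem' ha hb (by push_cast; ring)) μ vac
    simp only [modeLeft_apply] at this
    rw [← this, vac_mode, if_pos rfl]
    exact component_of_mem_of_ne _ hb (by simpa using hμ)
  rw [← mode_neg_one_vac (component isInternal μ (vac : V)), h]
  exact zero_mem _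

theorem T_eq_mode (a : V) : T a = mode Y a (-2) vac := by
  rw [← mode_neg_one_vac (T a), T_mode]; simp

theorem T_mem {μ : ℂ} {a : V} (ha : a ∈ wt μ) : T a ∈ wt (V := V) (μ + 1) := by
  rw [T_eq_mode]
  exact mode_mem' ha vac_mem_wt_zero (by push_cast; ring)

/-- Zhu's lemma: `Res ((1+z)^(⌈Re|a|⌉ + δ - 1 + m) / z^(1 + δ + n)) Y(a,z)b` lies in `O(V)` for
`n ≥ m ≥ 0`. -/
theorem resProd_mem_O {μ : ℂ} {a : V} (ha : a ∈ wt μ) (b : V) {p q : ℤ} (m n : ℕ) (hmn : m ≤ n)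
    (hp : p = ⌈μ.re⌉ + delta μ - 1 + m) (hq : q = 1 + delta μ + n) :
    resProd Y p q a b ∈ O V := by
  have hδ : 0 ≤ delta μ := by rcases delta_eq_zero_or_one μ with h | h <;> simp [h]
  subst hp hq
  induction n generalizing m μ a with
  | zero =>
    obtain rfl : m = 0 := by omega
    simpa using circ_of_mem ha b ▸ circ_mem a b
  | succ n ih =>
    -- The diagonal case: apply the induction hypothesis to `T a` and to `a`.
    have diag (k : ℕ) (hk : k ≤ n) :
        resProd Y (⌈μ.re⌉ + delta μ - 1 + (k + 1 : ℕ)) (1 + delta μ + (n + 1 : ℕ)) a b ∈ O V := by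
      have h1 := ih ha k hk hδ
      have hd : delta (μ + 1) = delta μ := by simpa using delta_add_intCast μ 1
      have hc : ⌈(μ + 1).re⌉ = ⌈μ.re⌉ + 1 := by simp
      have h2 := ih (T_mem ha) k hk (by rwa [hd])
      rw [hd, hc, resProd_of_derivative Y a (T a) fun n w => T_mode a w n] at h2
      have e1 : ⌈μ.re⌉ + 1 + delta μ - 1 + (k : ℤ) - 1 = ⌈μ.re⌉ + delta μ - 1 + k := by ring
      have e2 : ⌈μ.re⌉ + 1 + delta μ - 1 + (k : ℤ) = ⌈μ.re⌉ + delta μ - 1 + (k + 1 : ℕ) := by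
        push_cast; ring
      have e3 : 1 + delta μ + (n : ℤ) + 1 = 1 + delta μ + (n + 1 : ℕ) := by push_cast; ring
      rw [e1, e2, e3] at h2
      have h3 := add_mem h2 (zsmul_mem h1 (⌈μ.re⌉ + delta μ - 1 + (k + 1 : ℕ)))
      rw [sub_add_cancel, ← Int.cast_smul_eq_zsmul ℂ] at h3
      refine ((O V).smul_mem_iff ?_).1 h3
      exact_mod_cast (by omega : 1 + delta μ + (n : ℤ) ≠ 0)
    obtain _ | k := m
    · have h0 := diag 0 (by omega)
      rw [Nat.cast_add, Nat.cast_zero, zero_add, Nat.cast_one, resProd_add_one] at h0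
      have h1 := ih ha 0 (by omega) hδ
      have e3 : 1 + delta μ + ((n + 1 : ℕ) : ℤ) - 1 = 1 + delta μ + n := by push_cast; ring
      rw [e3] at h0
      simp only [Nat.cast_zero, add_zero] at h1 ⊢
      exact ((O V).add_mem_iff_left h1).1 h0
    · exact diag k (by omega)

theorem resProd_mem_O_of_delta_eq_zero {μ ν : ℂ} {a b : V} (ha : a ∈ wt μ) (hb : b ∈ wt ν)
    (h : delta (μ + ν) = 0) (p q : ℤ) : resProd Y p q a b ∈ O V := by
  refine resProd_mem _ _ _ _ _ _ fun i => ?_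
  refine mem_O_of_delta_eq_zero (mode_mem' ha hb (ν := μ + ν + (q - i - 1 : ℤ)) ?_) ?_
  · push_cast; ring
  · rw [delta_add_intCast, h]

end Graded

section Ideal

variable {V : Type u} [AddCommGroup V] [Module ℂ V] [CGradedVertexAlgebra V]

open VertexAlgebra CGradedVertexAlgebra

/-! ### Skew-symmetry modulo `O(V)` -/

open Finset in
/-- The instance of skew-symmetry modulo `O(V)` that is needed below. It is the two-variable
identity applied to the vacuum: since `Res f Y(e,z)𝟏` sees only the pole of `f`, the iterate side is
`Res ((1+z)^p / z) Y(a,z)b` plus elements of `O(V)`. -/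
theorem resProd_sub_resProd_swap_mem_O {μ ν : ℂ} {N : ℤ} (h : μ + ν = N) {a b : V} (ha : a ∈ wt μ)
    (hb : b ∈ wt ν) {p q : ℤ} (hpq : p + q = N - 1) :
    resProd Y p 1 a b - resProd Y q 1 b a ∈ O V := by
  obtain ⟨B, hB0, hB, hid⟩ := exists_resProd_identity jacobi p q (-1) (-1) 0 a b (vac : V)
  have e (i : ℕ) : (-1 : ℤ) + i = i - 1 := by ring
  have hR : ∑ t ∈ range B, ((-1) ^ t * Ring.choose (-1 : ℤ) t) •
      (resProd Y p (t - -1 - -1) a (resProd Y q (-0 - t) b (vac : V)) -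
        ((-1 : ℤ).negOnePow : ℤ) • resProd Y q (t - -1 - 0) b (resProd Y p (- -1 - t) a vac)) =
      resProd Y q 1 b a := by
    rw [sum_eq_single_of_mem 0 (mem_range.2 hB0)]
    · rw [resProd_vac_of_nonpos q _ (by simp)]
      simp [resProd_one_vac]
    · intro t _ ht
      rw [resProd_vac_of_nonpos q _ (by simp), resProd_vac_of_nonpos p _ (by omega)]
      simp
  rw [hR] at hid
  rw [← Submodule.ker_mkQ (O V), LinearMap.mem_ker, map_sub, sub_eq_zero, ← hid,
    resProd_eq_sum_range Y p 1 a b B fun i hi => by rw [← e, hB i hi]]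
  simp only [map_sum, map_zsmul]
  refine sum_congr rfl fun l _ => ?_
  rw [sum_eq_single_of_mem (l, 0) (by simp)]
  · simp [resProd_one_vac, e]
  · rintro ⟨s, t⟩ hx hne
    have hst := HasAntidiagonal.mem_antidiagonal.1 hx
    simp only at hst ⊢
    obtain _ | t := t
    · exact absurd (by simp [← hst]) hne
    refine (congrArg _ ((Submodule.Quotient.mk_eq_zero (O V)).2 ?_)).trans (smul_zero _)
    have hmem : mode Y a (-1 + l) b ∈ wt (V := V) ((N - l : ℤ) : ℂ) :=
      mode_mem' ha hb (by rw [h]; push_cast; ring)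
    refine resProd_mem_O hmem _ t t le_rfl ?_ ?_
    · rw [delta_intCast, Complex.intCast_re, Int.ceil_intCast]; omega
    · rw [delta_intCast]; omega

theorem delta_right_eq_zero {μ ν : ℂ} {N : ℤ} (h : μ + ν = N) (hμ : delta μ = 0) :
    delta ν = 0 := by
  refine (delta_eq_zero_or_one ν).resolve_right fun hν => ?_
  obtain ⟨K, rfl⟩ := eq_intCast_of_delta_eq_one hν
  rw [← delta_add_intCast μ K, h, delta_intCast] at hμ
  exact one_ne_zero hμ

/-- If `|b|` is nonintegral with integral real part, then `Res (1+z)^(Re|b| - 1) Y(b,z)d` lies in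
`O(V)`: modulo `O(V)` it is the difference of `d ∘ b`, rewritten by skew-symmetry, and `b ∘ d`. -/
theorem resProd_zero_mem_O {ν : ℂ} (hν : delta ν = 0) (hre : (⌈ν.re⌉ : ℝ) = ν.re) {b : V}
    (hb : b ∈ wt ν) (d : V) : resProd Y (⌈ν.re⌉ - 1) 0 b d ∈ O V := by
  refine wt_induction (P := fun d => resProd Y (⌈ν.re⌉ - 1) 0 b d ∈ O V) (fun μ d hd => ?_)
    (fun d d' h h' => by rw [map_add]; exact add_mem h h') d
  rcases delta_eq_zero_or_one (ν + μ) with h0 | h1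
  · exact resProd_mem_O_of_delta_eq_zero hb hd h0 _ _
  · obtain ⟨N, hN⟩ := eq_intCast_of_delta_eq_one h1
    have hμ := delta_right_eq_zero hN hν
    have hμre : ⌈μ.re⌉ = N - ⌈ν.re⌉ := by
      have : μ.re = ((N - ⌈ν.re⌉ : ℤ) : ℝ) := by
        have := congrArg Complex.re hN
        rw [Complex.add_re, Complex.intCast_re] at this
        push_cast
        linarith
      rw [this, Int.ceil_intCast]
    have h2 : resProd Y (⌈ν.re⌉ - 1) 1 b d ∈ O V :=
      resProd_mem_O hb d 0 0 le_rfl (by simp [hν]) (by simp [hν])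
    have h3 : resProd Y (⌈μ.re⌉ - 1) 1 d b ∈ O V :=
      resProd_mem_O hd b 0 0 le_rfl (by simp [hμ]) (by simp [hμ])
    have h4 := resProd_sub_resProd_swap_mem_O (by rw [add_comm, hN]) hd hb
      (p := ⌈μ.re⌉ - 1) (q := ⌈ν.re⌉ - 1 + 1) (by omega)
    rw [Submodule.sub_mem_iff_right _ h3, resProd_add_one] at h4
    exact ((O V).add_mem_iff_right h2).1 h4

/-- For `b` of nonintegral weight the exponent `⌊Re|b|⌋ + 1` is allowed for all pole orders `≥ 2`.
This follows from `resProd_mem_O` except when `Re|b|` is an integer and the pole order is `2`, where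
the exponent exceeds the bound by one and `resProd_zero_mem_O` makes up for it. -/
theorem resProd_mem_O_of_floor {ν : ℂ} (hν : delta ν = 0) {b : V} (hb : b ∈ wt ν) (d : V)
    {p q : ℤ} (t : ℕ) (hp : p = ⌊ν.re⌋ + 1) (hq : q = t + 2) : resProd Y p q b d ∈ O V := by
  have H {p q : ℤ} (m n : ℕ) (hmn : m ≤ n) (hp : p = ⌈ν.re⌉ - 1 + m) (hq : q = 1 + n) :
      resProd Y p q b d ∈ O V :=
    resProd_mem_O hb d m n hmn (by rw [hp, hν]; ring) (by rw [hq, hν]; ring)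
  by_cases hre : (⌈ν.re⌉ : ℝ) = ν.re
  · have hfl : ⌊ν.re⌋ = ⌈ν.re⌉ := by rw [← hre]; simp
    obtain _ | t := t
    · have h1 := H (p := ⌈ν.re⌉) (q := 2) 1 1 le_rfl (by simp) rfl
      have h2 := H (p := ⌈ν.re⌉ - 1) (q := 1) 0 0 le_rfl (by simp) rfl
      have h3 : resProd Y (⌈ν.re⌉ - 1 + 1) 1 b d ∈ O V := by
        rw [resProd_add_one]
        exact add_mem h2 (resProd_zero_mem_O hν hre hb d)
      rw [sub_add_cancel] at h3
      rw [hp, hq, hfl, Nat.cast_zero, zero_add, resProd_add_one]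
      exact add_mem h1 h3
    · exact H 2 (t + 2) (by omega) (by push_cast; omega) (by push_cast; omega)
  · have hfl : ⌈ν.re⌉ = ⌊ν.re⌋ + 1 := by
      refine le_antisymm (Int.ceil_le_floor_add_one _) (Int.add_one_le_of_lt ?_)
      refine (Int.floor_le_ceil _).lt_of_ne fun h => hre ?_
      exact le_antisymm (h ▸ Int.floor_le _) (Int.le_ceil _)
    exact H 1 (t + 1) (by omega) (by push_cast; omega) (by push_cast; omega)

/-! ### `O(V)` is a two-sided ideal -/

theorem star_resProd_of_delta_eq_zero {μ ν : ℂ} (h : delta (μ + ν) = 0) {a b : V} (ha : a ∈ wt μ)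
    (hb : b ∈ wt ν) (p q : ℤ) : star V (resProd Y p q a b) = 0 := by
  refine LinearMap.mem_ker.1 (resProd_mem _ _ _ _ _ _ fun i => ?_)
  rw [LinearMap.mem_ker]
  refine star_of_delta_eq_zero (mode_mem' ha hb (ν := μ + ν + (q - i - 1 : ℤ)) ?_) ?_
  · push_cast; ring
  · rw [delta_add_intCast, h]

open Finset in
/-- The iterate `(Res ((1+z)^p z^n) Y(a,z)b) ⋆ c` as a combination of residues of `Y(a,z)Y(b,w)c`
and `Y(b,w)Y(a,z)c`. -/
theorem exists_star_resProd_eq {μ ν : ℂ} {N : ℤ} (h : μ + ν = N) {a b : V} (ha : a ∈ wt μ)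
    (hb : b ∈ wt ν) (c : V) {p q n : ℤ} (hpq : p + q = N - n - 1) :
    ∃ B : ℕ, 0 < B ∧ star V (resProd Y p (-n) a b) c =
      ∑ t ∈ range B, ((-1) ^ t * Ring.choose n t) •
        (resProd Y p (t - n) a (resProd Y q (1 - t) b c) -
          (n.negOnePow : ℤ) • resProd Y q (t - n + 1) b (resProd Y p (-t) a c)) := by
  obtain ⟨B, hB0, hB, hid⟩ := exists_resProd_identity jacobi p q 0 n (-1) a b c
  refine ⟨B, hB0, ?_⟩
  have e (i : ℕ) : (i : ℤ) - -n = n + i := by ring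
  simp only [sub_zero, sub_neg_eq_add, neg_neg, neg_zero, zero_sub] at hid
  rw [← hid, resProd_eq_sum_range Y p (-n) a b B fun i hi => by rw [e, hB i hi]]
  simp only [map_sum, map_zsmul, LinearMap.sum_apply, LinearMap.smul_apply, e]
  refine sum_congr rfl fun l _ => ?_
  rw [sum_eq_single_of_mem (l, 0) (by simp)]
  · have hmem : mode Y a (n + l) b ∈ wt (V := V) ((p + q - l : ℤ) : ℂ) :=
      mode_mem' ha hb (by rw [h, hpq]; push_cast; ring)
    rw [star_of_mem_intCast hmem]
    simp
  · rintro ⟨s, t⟩ hx hne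
    have hst := HasAntidiagonal.mem_antidiagonal.1 hx
    obtain _ | t := t
    · exact absurd (by simpa using hst) hne
    · simp [Ring.choose_zero_succ]

theorem star_circ_mem_O (a b c : V) : star V (circ V a b) c ∈ O V := by
  refine wt_induction (P := fun a => star V (circ V a b) c ∈ O V) (fun μ a ha => ?_)
    (fun a a' h h' => by simpa using add_mem h h') a
  refine wt_induction (P := fun b => star V (circ V a b) c ∈ O V) (fun ν b hb => ?_)
    (fun b b' h h' => by simpa using add_mem h h') b
  rcases delta_eq_zero_or_one (μ + ν) with h0 | h1
  · rw [circ_of_mem ha, star_resProd_of_delta_eq_zero h0 ha hb]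
    exact zero_mem _
  obtain ⟨N, hN⟩ := eq_intCast_of_delta_eq_one h1
  rcases delta_eq_zero_or_one μ with hμ | hμ
  · obtain ⟨B, -, hB⟩ := exists_star_resProd_eq hN ha hb c (p := ⌈μ.re⌉ - 1)
      (q := N - (⌈μ.re⌉ - 1)) (n := -1) (by ring)
    rw [neg_neg] at hB
    rw [circ_of_delta_eq_zero ha hμ, hB]
    refine sum_mem fun t _ => zsmul_mem (sub_mem ?_ (zsmul_mem ?_ _)) _
    · exact resProd_mem_O ha _ 0 t (by omega) (by simp [hμ]) (by rw [hμ]; ring)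
    · refine resProd_mem_O_of_floor (delta_right_eq_zero hN hμ) hb _ t ?_ (by ring)
      have : ν.re = N + -μ.re := by
        have := congrArg Complex.re hN
        rw [Complex.add_re, Complex.intCast_re] at this
        linarith
      rw [this, Int.floor_intCast_add, Int.floor_neg]
      ring
  · obtain ⟨K, rfl⟩ := eq_intCast_of_delta_eq_one hμ
    obtain ⟨L, rfl⟩ : ∃ L : ℤ, ν = L := ⟨N - K, by push_cast; rw [← hN]; ring⟩
    obtain ⟨B, -, hB⟩ := exists_star_resProd_eq hN ha hb c (p := K) (q := L + 1) (n := -2)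
      (by have : K + L = N := by exact_mod_cast hN
          omega)
    rw [neg_neg] at hB
    rw [circ_of_mem_intCast ha, hB]
    refine sum_mem fun t _ => zsmul_mem (sub_mem ?_ (zsmul_mem ?_ _)) _
    · exact resProd_mem_O ha _ 0 t (by omega) (by simp [delta_intCast])
        (by rw [delta_intCast]; ring)
    · exact resProd_mem_O hb _ 1 (t + 1) (by omega) (by simp [delta_intCast])
        (by rw [delta_intCast]; push_cast; ring)

theorem star_mem_O_of_left {x : V} (hx : x ∈ O V) (c : V) : star V x c ∈ O V := by
  have : O V ≤ (O V).comap ((star V).flip c) := by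
    refine Submodule.span_le.2 ?_
    rintro _ ⟨a, b, rfl⟩
    exact star_circ_mem_O a b c
  exact this hx

open Finset in
theorem star_mem_O_of_right (c : V) {x : V} (hx : x ∈ O V) : star V c x ∈ O V := by
  refine wt_induction (P := fun c => star V c x ∈ O V) (fun lam c hc => ?_)
    (fun a a' h h' => by simpa using add_mem h h') c
  rcases delta_eq_zero_or_one lam with h0 | h1
  · rw [star_of_delta_eq_zero hc h0]; exact zero_mem _
  obtain ⟨K, rfl⟩ := eq_intCast_of_delta_eq_one h1
  have : O V ≤ (O V).comap (star V c) := by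
    refine Submodule.span_le.2 ?_
    rintro _ ⟨a, b, rfl⟩
    change star V c (circ V a b) ∈ O V
    refine wt_induction (P := fun a => star V c (circ V a b) ∈ O V) (fun μ a ha => ?_)
      (fun a a' h h' => by simpa using add_mem h h') a
    -- By the commutator formula `c ⋆ (a ∘ b) - a ∘ (c ⋆ b)` is a sum of elements of `O(V)`.
    obtain ⟨B, hB0, hB, hid⟩ := exists_resProd_identity jacobi K (⌈μ.re⌉ + delta μ - 1) (-1) 0
      (-(1 + delta μ)) c a b
    rw [sum_eq_single_of_mem (s := range B) (a := 0) (h := mem_range.2 hB0)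
      (f := fun t => ((-1) ^ t * Ring.choose (0 : ℤ) t) • _)] at hid
    · simp only [pow_zero, Ring.choose_zero_right, mul_one, one_smul, Nat.cast_zero, zero_sub,
        sub_zero, neg_neg, Int.negOnePow_zero, Units.val_one] at hid
      rw [star_of_mem_intCast hc, circ_of_mem ha, ← sub_add_cancel (resProd Y K 1 c _), ← hid,
        ← circ_of_mem ha]
      refine add_mem (sum_mem fun l _ => sum_mem ?_) (circ_mem _ _)
      rintro ⟨s, t⟩ hx
      have hst := HasAntidiagonal.mem_antidiagonal.1 hx
      simp only at hst ⊢
      have hmem : mode Y c (0 + l) a ∈ wt (V := V) (μ + (K - l - 1 : ℤ)) :=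
        mode_mem' hc ha (by push_cast; ring)
      refine zsmul_mem (resProd_mem_O hmem _ (t + 1) (t + 1) le_rfl ?_ ?_) _
      · rw [ceil_re_add_intCast, delta_add_intCast]; push_cast; omega
      · rw [delta_add_intCast]; push_cast; ring
    · intro t _ ht
      obtain ⟨t, rfl⟩ := Nat.exists_eq_succ_of_ne_zero ht
      simp [Ring.choose_zero_succ]
  exact this hx

theorem star_assoc_mem_O (a b c : V) : star V (star V a b) c - star V a (star V b c) ∈ O V := by
  refine wt_induction (P := fun a => star V (star V a b) c - star V a (star V b c) ∈ O V)
    (fun μ a ha => ?_)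
    (fun a a' h h' => by simpa [add_sub_add_comm] using add_mem h h') a
  refine wt_induction (P := fun b => star V (star V a b) c - star V a (star V b c) ∈ O V)
    (fun ν b hb => ?_)
    (fun a a' h h' => by simpa [add_sub_add_comm] using add_mem h h') b
  rcases delta_eq_zero_or_one μ with hμ | hμ
  · simp [star_of_delta_eq_zero ha hμ]
  obtain ⟨K, rfl⟩ := eq_intCast_of_delta_eq_one hμ
  rcases delta_eq_zero_or_one ν with hν | hν
  · rw [star_of_mem_intCast ha, star_resProd_of_delta_eq_zero (by rwa [delta_intCast_add]) ha hb,
      star_of_delta_eq_zero hb hν]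
    simp
  obtain ⟨L, rfl⟩ := eq_intCast_of_delta_eq_one hν
  obtain ⟨B, hB0, hB⟩ := exists_star_resProd_eq (N := K + L) (by push_cast; rfl) ha hb c (p := K)
    (q := L) (n := -1) (by ring)
  rw [star_of_mem_intCast ha, star_of_mem_intCast ha, star_of_mem_intCast hb]
  obtain ⟨B, rfl⟩ := Nat.exists_eq_succ_of_ne_zero hB0.ne'
  rw [neg_neg, Finset.sum_range_succ'] at hB
  rw [hB, add_sub_assoc]
  have h2 (t : ℕ) (d : V) : resProd Y L (t - -1 + 1) b d ∈ O V :=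
    resProd_mem_O hb _ 0 t (by omega) (by simp [delta_intCast]) (by rw [delta_intCast]; ring)
  refine add_mem (sum_mem fun t _ => zsmul_mem (sub_mem ?_ (zsmul_mem (h2 _ _) _)) _) ?_
  · exact resProd_mem_O ha _ 0 t (by omega) (by simp [delta_intCast])
      (by rw [delta_intCast]; push_cast; ring)
  · have := h2 0 (resProd Y K 0 a c)
    simpa using this

theorem vac_star (a : V) : star V vac a = a := by
  have h : (vac : V) ∈ wt ((0 : ℤ) : ℂ) := by simpa using vac_mem_wt_zero
  rw [star_of_mem_intCast h, resProd_eq_sum_range _ _ _ _ _ 1]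
  · simp [vac_mode]
  · intro i hi
    rw [vac_mode, if_neg (by omega)]

theorem star_vac_sub_mem_O (a : V) : star V a vac - a ∈ O V := by
  refine wt_induction (P := fun a => star V a vac - a ∈ O V) (fun μ a ha => ?_)
    (fun a a' h h' => by simpa [add_sub_add_comm] using add_mem h h') a
  rcases delta_eq_zero_or_one μ with hμ | hμ
  · rw [star_of_delta_eq_zero ha hμ]
    simpa using mem_O_of_delta_eq_zero ha hμ
  · rw [star_of_mem ha, hμ, resProd_one_vac, one_smul, sub_self]
    exact zero_mem _

end Ideal

section Zhu

variable {V : Type u} [AddCommGroup V] [Module ℂ V] [CGradedVertexAlgebra V]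

open VertexAlgebra CGradedVertexAlgebra

/-! ### The algebra `A(V)` -/

-- The instances are local, so that the operations on `A(V)` in the theorem are those of the ring
-- and module structures whose existence it asserts.

local instance zhuAddCommGroup : AddCommGroup (ZhuAlgebra V) :=
  inferInstanceAs (AddCommGroup (V ⧸ O V))

local instance zhuModule : Module ℂ (ZhuAlgebra V) := inferInstanceAs (Module ℂ (V ⧸ O V))

theorem toZhu_surjective : Function.Surjective (toZhu V) := Submodule.Quotient.mk_surjective _

theorem toZhu_add (a b : V) : toZhu V (a + b) = toZhu V a + toZhu V b := rfl

theorem toZhu_smul (c : ℂ) (a : V) : toZhu V (c • a) = c • toZhu V a := rfl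

theorem toZhu_eq_iff {a b : V} : toZhu V a = toZhu V b ↔ a - b ∈ O V := Submodule.Quotient.eq _

/-- The product on `A(V)` induced by `⋆`. -/
def mulMap : (V ⧸ O V) →ₗ[ℂ] (V ⧸ O V) →ₗ[ℂ] (V ⧸ O V) :=
  (O V).liftQ
    { toFun := fun a => (O V).mapQ (O V) (star V a) fun _ hx => star_mem_O_of_right a hx
      map_add' := fun a b => by ext; simp
      map_smul' := fun c a => by ext; simp }
    fun a ha => by
      ext b
      exact (Submodule.Quotient.mk_eq_zero (O V)).2 (star_mem_O_of_left ha b)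

local instance zhuMul : Mul (ZhuAlgebra V) := ⟨fun x y => mulMap (V := V) x y⟩

local instance zhuOne : One (ZhuAlgebra V) := ⟨toZhu V vac⟩

theorem toZhu_star (a b : V) : toZhu V (star V a b) = toZhu V a * toZhu V b := rfl

theorem toZhu_vac : toZhu V vac = 1 := rfl

local instance zhuRing : Ring (ZhuAlgebra V) where
  __ := (inferInstance : AddCommGroup (ZhuAlgebra V))
  left_distrib x y z := map_add (mulMap (V := V) x) y z
  right_distrib x y z := LinearMap.map_add₂ (mulMap (V := V)) x y z
  zero_mul x := LinearMap.map_zero₂ (mulMap (V := V)) x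
  mul_zero x := map_zero (mulMap (V := V) x)
  mul_assoc x y z := by
    obtain ⟨a, rfl⟩ := toZhu_surjective x
    obtain ⟨b, rfl⟩ := toZhu_surjective y
    obtain ⟨c, rfl⟩ := toZhu_surjective z
    simp only [← toZhu_star]
    exact toZhu_eq_iff.2 (star_assoc_mem_O a b c)
  one_mul x := by
    obtain ⟨a, rfl⟩ := toZhu_surjective x
    rw [← toZhu_vac, ← toZhu_star, vac_star]
  mul_one x := by
    obtain ⟨a, rfl⟩ := toZhu_surjective x
    rw [← toZhu_vac, ← toZhu_star]
    exact toZhu_eq_iff.2 (star_vac_sub_mem_O a)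

local instance zhuAlgebra : Algebra ℂ (ZhuAlgebra V) :=
  Algebra.ofModule (fun r x y => LinearMap.map_smul₂ (mulMap (V := V)) r x y)
    fun r x y => map_smul (mulMap (V := V) x) r y

/-! ### Zero modes on lowest weight vectors -/

namespace AdmissibleModule

variable (M : AdmissibleModule.{u, w} V)

theorem zeroMode_of_mem {μ : ℂ} {a : V} (ha : a ∈ wt μ) :
    M.zeroMode a = mode M.YM a (⌈μ.re⌉ - 1) := by
  rw [zeroMode, linExt_of_mem _ ha]; rfl

theorem zeroMode_of_mem_intCast {N : ℤ} {a : V} (ha : a ∈ wt (N : ℂ)) :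
    M.zeroMode a = mode M.YM a (N - 1) := by
  rw [zeroMode_of_mem M ha, Complex.intCast_re, Int.ceil_intCast]

/-- The vectors killed by the modes `a(n)` with `n ≥ Re|a| - 1` and `n ≠ |a| - 1`: lowest weight
vectors without the requirement of homogeneity. -/
def annihilated : Submodule ℂ M.carrier where
  carrier := {x | ∀ (lam : ℂ) (a : V) (n : ℤ), a ∈ wt lam → lam.re - 1 ≤ n → (n : ℂ) ≠ lam - 1 →
    mode M.YM a n x = 0}
  add_mem' hx hy lam a n ha h h' := by
    rw [map_add, hx lam a n ha h h', hy lam a n ha h h', add_zero]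
  zero_mem' _ _ _ _ _ _ := map_zero _
  smul_mem' c x hx lam a n ha h h' := by rw [map_smul, hx lam a n ha h h', smul_zero]

variable {M}

theorem mode_eq_zero {x : M.carrier} (hx : x ∈ M.annihilated) {lam : ℂ} {a : V} (ha : a ∈ wt lam)
    {n : ℤ} (h : lam.re - 1 ≤ n) (h' : (n : ℂ) ≠ lam - 1) : mode M.YM a n x = 0 :=
  hx lam a n ha h h'

theorem mode_intCast_eq_zero {x : M.carrier} (hx : x ∈ M.annihilated) {N : ℤ} {a : V}
    (ha : a ∈ wt (N : ℂ)) {n : ℤ} (h : N ≤ n) : mode M.YM a n x = 0 := by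
  refine mode_eq_zero hx ha ?_ ?_
  · rw [Complex.intCast_re]; exact_mod_cast (by omega : N - 1 ≤ n)
  · exact_mod_cast (by omega : n ≠ N - 1)

theorem mode_eq_zero_of_delta {x : M.carrier} (hx : x ∈ M.annihilated) {μ : ℂ} {a : V}
    (ha : a ∈ wt μ) (hμ : delta μ = 0) {n : ℤ} (h : μ.re - 1 ≤ n) : mode M.YM a n x = 0 := by
  refine mode_eq_zero hx ha h fun h' => ?_
  have : μ = ((n + 1 : ℤ) : ℂ) := by push_cast; rw [h']; ring
  rw [this, delta_intCast] at hμ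
  exact one_ne_zero hμ

theorem isLowestWeight_iff {x : M.carrier} :
    IsLowestWeight wt M.YM M.gr x ↔ (∃ μ, x ∈ M.gr μ) ∧ x ∈ M.annihilated := by
  refine and_congr_right fun _ => forall_congr' fun lam => forall_congr' fun a =>
    forall_congr' fun n => forall_congr' fun ha => ?_
  rw [not_imp_comm, not_or, not_lt]
  tauto

theorem vacuumSpace_le_annihilated : M.vacuumSpace ≤ M.annihilated :=
  Submodule.span_le.2 fun _ hx => (isLowestWeight_iff.1 hx).2

/-- The conditions defining `annihilated` are homogeneous, so they hold for a vector if and only if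
they hold for its homogeneous components. -/
theorem vacuumSpace_eq_annihilated : M.vacuumSpace = M.annihilated := by
  refine le_antisymm vacuumSpace_le_annihilated fun x hx => ?_
  refine mem_of_component_mem M.isInternal _ _ fun μ => Submodule.subset_span ?_
  refine isLowestWeight_iff.2 ⟨⟨μ, component_mem _ _ _⟩, fun lam a n ha h h' => ?_⟩
  rw [← component_map M.isInternal M.isInternal (mode M.YM a n) (lam - n - 1)
    (fun ν y hy => by simpa [add_sub_assoc] using M.mode_mem lam ν a y n ha hy),
    hx lam a n ha h h', map_zero]

theorem zeroMode_eq_zero_of_delta {x : M.carrier} (hx : x ∈ M.annihilated) {μ : ℂ} {a : V}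
    (ha : a ∈ wt μ) (hμ : delta μ = 0) : M.zeroMode a x = 0 := by
  rw [zeroMode_of_mem M ha]
  exact mode_eq_zero_of_delta hx ha hμ (by push_cast; linarith [Int.le_ceil μ.re])

/-- By the commutator formula, zero modes preserve the conditions defining lowest weight vectors. -/
theorem zeroMode_mem_annihilated (b : V) {x : M.carrier} (hx : x ∈ M.annihilated) :
    M.zeroMode b x ∈ M.annihilated := by
  refine wt_induction (P := fun b => M.zeroMode b x ∈ M.annihilated) (fun ν b hb => ?_)
    (fun b b' h h' => by rw [map_add]; exact add_mem h h') b
  rcases delta_eq_zero_or_one ν with hν | hν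
  · rw [zeroMode_eq_zero_of_delta hx hb hν]; exact zero_mem _
  obtain ⟨L, rfl⟩ := eq_intCast_of_delta_eq_one hν
  rw [zeroMode_of_mem_intCast M hb]
  intro lam a n ha h h'
  have hJ := M.jacobi a b x n 0 (L - 1)
  rw [finsum_eq_sum_range _ 0, finsum_eq_sum_range _ 1] at hJ
  · have h0 := mode_eq_zero hx ha h h'
    simpa [h0] using hJ.symm
  · intro j hj
    obtain ⟨j, rfl⟩ := Nat.exists_eq_succ_of_ne_zero (by omega : j ≠ 0)
    simp [Ring.choose_zero_succ]
  · intro i _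
    have hmem : mode Y a (0 + i) b ∈ wt (V := V) (lam + (L - i - 1 : ℤ)) :=
      mode_mem' ha hb (by push_cast; ring)
    rw [mode_eq_zero hx hmem, smul_zero]
    · rw [Complex.add_re, Complex.intCast_re]; push_cast; linarith
    · intro h2
      apply h'
      push_cast at h2
      linear_combination h2

/-- The Jacobi identity as a formula for the zero mode of `Res ((1+z)^p z^n) Y(a,z)b`. -/
theorem zeroMode_resProd {μ ν : ℂ} {N : ℤ} (h : μ + ν = N) {a b : V} (ha : a ∈ wt μ)
    (hb : b ∈ wt ν) (x : M.carrier) {p n k : ℤ} (hk : p + k = N - n - 2) :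
    M.zeroMode (resProd Y p (-n) a b) x =
      ∑ᶠ j : ℕ, ((-1) ^ j * Ring.choose n j) •
        (mode M.YM a (p + n - j) (mode M.YM b (k + j) x) -
          (n.negOnePow : ℤ) • mode M.YM b (n + k - j) (mode M.YM a (p + j) x)) := by
  obtain ⟨B, hB⟩ := (eventually_mode_add_eq_zero Y a b n).exists_forall_of_atTop
  have e (i : ℕ) : (i : ℤ) - -n = n + i := by ring
  rw [← M.jacobi, finsum_eq_sum_range _ B fun i hi => by rw [hB i hi]; simp [mode],
    resProd_eq_sum_range Y p (-n) a b B fun i hi => by rw [e, hB i hi]]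
  simp only [map_sum, map_zsmul, LinearMap.sum_apply, LinearMap.smul_apply, e]
  refine Finset.sum_congr rfl fun i _ => ?_
  have hmem : mode Y a (n + i) b ∈ wt (V := V) ((N - n - i - 1 : ℤ) : ℂ) :=
    mode_mem' ha hb (by rw [h]; push_cast; ring)
  rw [zeroMode_of_mem_intCast M hmem]
  congr 3
  omega

theorem zeroMode_resProd_of_delta_eq_zero {x : M.carrier} (hx : x ∈ M.annihilated) {μ ν : ℂ}
    (h : delta (μ + ν) = 0) {a b : V} (ha : a ∈ wt μ) (hb : b ∈ wt ν) (p q : ℤ) :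
    M.zeroMode (resProd Y p q a b) x = 0 := by
  refine (LinearMap.mem_ker (f := M.zeroMode.flip x)).1 (resProd_mem _ _ _ _ _ _ fun i => ?_)
  rw [LinearMap.mem_ker, LinearMap.flip_apply]
  refine zeroMode_eq_zero_of_delta hx (μ := μ + ν + (q - i - 1 : ℤ)) (mode_mem' ha hb ?_) ?_
  · push_cast; ring
  · rw [delta_add_intCast, h]

theorem zeroMode_circ {x : M.carrier} (hx : x ∈ M.annihilated) (a b : V) :
    M.zeroMode (circ V a b) x = 0 := by
  refine wt_induction (P := fun a => M.zeroMode (circ V a b) x = 0) (fun μ a ha => ?_)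
    (fun a a' h h' => by simp [h, h']) a
  refine wt_induction (P := fun b => M.zeroMode (circ V a b) x = 0) (fun ν b hb => ?_)
    (fun a a' h h' => by simp [h, h']) b
  rcases delta_eq_zero_or_one (μ + ν) with h0 | h1
  · rw [circ_of_mem ha, zeroMode_resProd_of_delta_eq_zero hx h0 ha hb]
  obtain ⟨N, hN⟩ := eq_intCast_of_delta_eq_one h1
  -- All modes occurring on the right side of the Jacobi identity kill `x`.
  rcases delta_eq_zero_or_one μ with hμ | hμ
  · have hν := delta_right_eq_zero hN hμ
    have hre : μ.re + ν.re = N := by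
      have := congrArg Complex.re hN
      rwa [Complex.add_re, Complex.intCast_re] at this
    have h := zeroMode_resProd hN ha hb x (p := ⌈μ.re⌉ - 1) (n := -1) (k := N - ⌈μ.re⌉) (by ring)
    rw [neg_neg] at h
    rw [circ_of_delta_eq_zero ha hμ, h]
    refine (finsum_congr fun j => ?_).trans finsum_zero
    rw [mode_eq_zero_of_delta hx ha hμ, mode_eq_zero_of_delta hx hb hν]
    · simp
    · push_cast; linarith [Int.ceil_lt_add_one μ.re, (Nat.cast_nonneg j : (0 : ℝ) ≤ j)]
    · push_cast; linarith [Int.le_ceil μ.re, (Nat.cast_nonneg j : (0 : ℝ) ≤ j)]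
  · obtain ⟨K, rfl⟩ := eq_intCast_of_delta_eq_one hμ
    obtain ⟨L, rfl⟩ : ∃ L : ℤ, ν = L := ⟨N - K, by push_cast; rw [← hN]; ring⟩
    have hKL : K + L = N := by exact_mod_cast hN
    have h := zeroMode_resProd hN ha hb x (p := K) (n := -2) (k := L) (by omega)
    rw [neg_neg] at h
    rw [circ_of_mem_intCast ha, h]
    refine (finsum_congr fun j => ?_).trans finsum_zero
    rw [mode_intCast_eq_zero hx ha (by omega), mode_intCast_eq_zero hx hb (by omega)]
    simp

theorem zeroMode_eq_zero_of_mem_O {x : M.carrier} (hx : x ∈ M.annihilated) {a : V} (ha : a ∈ O V) :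
    M.zeroMode a x = 0 := by
  have : O V ≤ LinearMap.ker (M.zeroMode.flip x) := by
    refine Submodule.span_le.2 ?_
    rintro _ ⟨a, b, rfl⟩
    exact zeroMode_circ hx a b
  exact this ha

theorem zeroMode_star {x : M.carrier} (hx : x ∈ M.annihilated) (a b : V) :
    M.zeroMode (star V a b) x = M.zeroMode a (M.zeroMode b x) := by
  refine wt_induction (P := fun a => M.zeroMode (star V a b) x = M.zeroMode a (M.zeroMode b x))
    (fun μ a ha => ?_) (fun a a' h h' => by simp [h, h']) a
  refine wt_induction (P := fun b => M.zeroMode (star V a b) x = M.zeroMode a (M.zeroMode b x))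
    (fun ν b hb => ?_) (fun a a' h h' => by simp [h, h']) b
  rcases delta_eq_zero_or_one μ with hμ | hμ
  · rw [star_of_delta_eq_zero ha hμ,
      zeroMode_eq_zero_of_delta (zeroMode_mem_annihilated b hx) ha hμ]
    simp
  obtain ⟨K, rfl⟩ := eq_intCast_of_delta_eq_one hμ
  rcases delta_eq_zero_or_one ν with hν | hν
  · rw [star_of_mem_intCast ha,
      zeroMode_resProd_of_delta_eq_zero hx (by rwa [delta_intCast_add]) ha hb,
      zeroMode_eq_zero_of_delta hx hb hν, map_zero]
  obtain ⟨L, rfl⟩ := eq_intCast_of_delta_eq_one hν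
  have h := zeroMode_resProd (N := K + L) (by push_cast; rfl) ha hb x (p := K) (n := -1)
    (k := L - 1) (by ring)
  rw [neg_neg] at h
  -- Only `a(K - 1) b(L - 1) x` survives on the right side of the Jacobi identity.
  rw [star_of_mem_intCast ha, h, finsum_eq_sum_range _ 1, zeroMode_of_mem_intCast M ha,
    zeroMode_of_mem_intCast M hb]
  · have h0 := mode_intCast_eq_zero hx ha (n := K) le_rfl
    simp [h0, ← sub_eq_add_neg]
  · intro j hj
    rw [mode_intCast_eq_zero hx ha (by omega), mode_intCast_eq_zero hx hb (by omega)]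
    simp

theorem zeroMode_vac (x : M.carrier) : M.zeroMode vac x = x := by
  have h : (vac : V) ∈ wt ((0 : ℤ) : ℂ) := by simpa using vac_mem_wt_zero
  rw [zeroMode_of_mem_intCast M h, M.vac_mode]
  simp

/-! ### The functor `Ω` -/

variable (M N : AdmissibleModule.{u, w} V)

theorem mem_vacuumSpace_iff {M : AdmissibleModule.{u, w} V} {x : M.carrier} :
    x ∈ M.vacuumSpace ↔ x ∈ M.annihilated := by
  rw [vacuumSpace_eq_annihilated]

/-- The action of `V` on `Ω(M)` by zero modes. -/
def vacuumAction : V →ₗ[ℂ] Module.End ℂ M.vacuumSpace where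
  toFun a := (M.zeroMode a).restrict fun _ hx =>
    mem_vacuumSpace_iff.2 (zeroMode_mem_annihilated a (mem_vacuumSpace_iff.1 hx))
  map_add' a b := by ext; simp
  map_smul' c a := by ext; simp

/-- The action of `A(V)` on `Ω(M)` by zero modes. -/
def zhuAction : (V ⧸ O V) →ₗ[ℂ] Module.End ℂ M.vacuumSpace :=
  (O V).liftQ M.vacuumAction fun a ha => by
    ext x
    exact zeroMode_eq_zero_of_mem_O (mem_vacuumSpace_iff.1 x.2) ha

local instance vacuumSMul : SMul (ZhuAlgebra V) M.vacuumSpace := ⟨fun s x => M.zhuAction s x⟩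

theorem coe_toZhu_smul (a : V) (x : M.vacuumSpace) :
    ((toZhu V a • x : M.vacuumSpace) : M.carrier) = M.zeroMode a x := rfl

local instance vacuumModule : Module (ZhuAlgebra V) M.vacuumSpace where
  one_smul x := Subtype.ext (zeroMode_vac (x : M.carrier))
  mul_smul s t x := by
    obtain ⟨a, rfl⟩ := toZhu_surjective s
    obtain ⟨b, rfl⟩ := toZhu_surjective t
    exact Subtype.ext (zeroMode_star (mem_vacuumSpace_iff.1 x.2) a b)
  smul_zero s := map_zero (M.zhuAction s)
  smul_add s x y := map_add (M.zhuAction s) x y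
  add_smul s t x := LinearMap.map_add₂ M.zhuAction s t x
  zero_smul x := LinearMap.map_zero₂ M.zhuAction x

theorem gr_zero_le_vacuumSpace : M.gr 0 ≤ M.vacuumSpace := by
  intro x hx
  rw [mem_vacuumSpace_iff]
  intro lam a n ha h h'
  have hmem := M.mode_mem lam 0 a x n ha hx
  rw [M.gr_eq_bot] at hmem
  · exact (Submodule.mem_bot ℂ).1 hmem
  · intro h0
    exact h' (by linear_combination -h0)
  · simp only [Complex.sub_re, Complex.add_re, Complex.zero_re, Complex.intCast_re, Complex.one_re]
    linarith

theorem zeroMode_mem_gr_zero (a : V) {x : M.carrier} (hx : x ∈ M.gr 0) :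
    M.zeroMode a x ∈ M.gr 0 := by
  refine wt_induction (P := fun a => M.zeroMode a x ∈ M.gr 0) (fun μ a ha => ?_)
    (fun a a' h h' => by rw [map_add]; exact add_mem h h') a
  rcases delta_eq_zero_or_one μ with hμ | hμ
  · rw [zeroMode_eq_zero_of_delta (mem_vacuumSpace_iff.1 (M.gr_zero_le_vacuumSpace hx)) ha hμ]
    exact zero_mem _
  · obtain ⟨K, rfl⟩ := eq_intCast_of_delta_eq_one hμ
    rw [zeroMode_of_mem_intCast M ha]
    simpa using M.mode_mem K 0 a x (K - 1) ha hx

variable {M N}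

theorem homMap_zeroMode (f : M ⟶ N) (a : V) (x : M.carrier) :
    homMap f (M.zeroMode a x) = N.zeroMode a (homMap f x) := by
  refine wt_induction (P := fun a => homMap f (M.zeroMode a x) = N.zeroMode a (homMap f x))
    (fun μ a ha => ?_) (fun a a' h h' => by simp [h, h']) a
  rw [zeroMode_of_mem M ha, zeroMode_of_mem N ha]
  exact Hom.map_mode f a _ x

/-- Morphisms need not preserve weights, but they preserve the annihilation conditions that
describe `Ω`. -/
theorem homMap_mem_vacuumSpace (f : M ⟶ N) {x : M.carrier} (hx : x ∈ M.vacuumSpace) :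
    homMap f x ∈ N.vacuumSpace := by
  rw [mem_vacuumSpace_iff] at hx ⊢
  intro lam a n ha h h'
  have := Hom.map_mode f a n x
  rw [hx lam a n ha h h', map_zero] at this
  exact this.symm

/-- The restriction of a morphism to the spaces `Ω`. -/
def vacuumMap (f : M ⟶ N) : M.vacuumSpace →ₗ[ZhuAlgebra V] N.vacuumSpace where
  toFun x := ⟨homMap f x, homMap_mem_vacuumSpace f x.2⟩
  map_add' x y := Subtype.ext (map_add (homMap f) _ _)
  map_smul' s x := by
    obtain ⟨a, rfl⟩ := toZhu_surjective s
    exact Subtype.ext (homMap_zeroMode f a x)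

/-- The functor `M ↦ Ω(M)`. -/
def vacuumFunctor : AdmissibleModule.{u, w} V ⥤ ModuleCat.{w} (ZhuAlgebra V) where
  obj M := ModuleCat.of (ZhuAlgebra V) M.vacuumSpace
  map f := ModuleCat.ofHom (vacuumMap f)
  map_id _ := rfl
  map_comp _ _ := rfl

end AdmissibleModule

end Zhu

end VA

end

theorem mainTheorem2 (V : Type u) [AddCommGroup V] [Module ℂ V] [VA.CGradedVertexAlgebra V] :
    -- `A(V) = V / O(V)` is a unital associative algebra for the product induced by `⋆`
    ∃ (_ : Ring (VA.ZhuAlgebra V)) (_ : Algebra ℂ (VA.ZhuAlgebra V)),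
      (∀ a b : V, VA.toZhu V (a + b) = VA.toZhu V a + VA.toZhu V b) ∧
      (∀ (c : ℂ) (a : V), VA.toZhu V (c • a) = c • VA.toZhu V a) ∧
      (∀ a b : V, VA.toZhu V (VA.star V a b) = VA.toZhu V a * VA.toZhu V b) ∧
      VA.toZhu V VA.VertexAlgebra.vac = 1 ∧
      -- `O(V)` annihilates `Ω(M)`, and `o(a ⋆ b) = o(a) o(b)` on `Ω(M)`
      (∀ M : VA.AdmissibleModule.{u, w} V, ∀ x ∈ M.vacuumSpace,
        (∀ a ∈ VA.O V, M.zeroMode a x = 0) ∧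
        (∀ a b : V, M.zeroMode (VA.star V a b) x = M.zeroMode a (M.zeroMode b x))) ∧
      -- `A(V)` acts on `Ω(M)` through zero modes
      ∃ (_ : ∀ M : VA.AdmissibleModule.{u, w} V, Module (VA.ZhuAlgebra V) M.vacuumSpace),
        (∀ (M : VA.AdmissibleModule.{u, w} V) (a : V) (x : M.vacuumSpace),
          ((VA.toZhu V a • x : M.vacuumSpace) : M.carrier) = M.zeroMode a x) ∧
        -- the lowest weight space `M(0)` is an `A(V)`-submodule of `Ω(M)`
        (∀ M : VA.AdmissibleModule.{u, w} V, M.gr 0 ≤ M.vacuumSpace ∧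
          ∀ (s : VA.ZhuAlgebra V) (x : M.vacuumSpace), (x : M.carrier) ∈ M.gr 0 →
            ((s • x : M.vacuumSpace) : M.carrier) ∈ M.gr 0) ∧
        -- `M ↦ Ω(M)`, `f ↦ f|Ω(M)` is a functor to `A(V)`-modules
        ∃ (F : VA.AdmissibleModule.{u, w} V ⥤ ModuleCat.{w} (VA.ZhuAlgebra V))
          (hF : ∀ M, F.obj M = ModuleCat.of (VA.ZhuAlgebra V) M.vacuumSpace),
          ∀ (M N : VA.AdmissibleModule.{u, w} V) (f : M ⟶ N),
            ∃ g : M.vacuumSpace →ₗ[VA.ZhuAlgebra V] N.vacuumSpace,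
              (∀ x : M.vacuumSpace,
                (g x : N.carrier) = VA.AdmissibleModule.homMap f (x : M.carrier)) ∧
              F.map f = eqToHom (hF M) ≫ ModuleCat.ofHom g ≫ eqToHom (hF N).symm := by
  refine ⟨VA.zhuRing, VA.zhuAlgebra, VA.toZhu_add, VA.toZhu_smul,
    VA.toZhu_star, VA.toZhu_vac, fun M x hx => ?_, VA.AdmissibleModule.vacuumModule,
    VA.AdmissibleModule.coe_toZhu_smul, fun M => ⟨M.gr_zero_le_vacuumSpace, fun s x hx => ?_⟩,
    VA.AdmissibleModule.vacuumFunctor, fun M => rfl, fun M N f =>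
      ⟨VA.AdmissibleModule.vacuumMap f, fun x => rfl, ?_⟩⟩
  · rw [VA.AdmissibleModule.mem_vacuumSpace_iff] at hx
    exact ⟨fun a => VA.AdmissibleModule.zeroMode_eq_zero_of_mem_O hx,
      VA.AdmissibleModule.zeroMode_star hx⟩
  · obtain ⟨a, rfl⟩ := VA.toZhu_surjective s
    exact M.zeroMode_mem_gr_zero a hx
  · exact ((Category.id_comp _).trans (Category.comp_id _)).symm
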